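/- Let $\psi_L(n,t),\psi_R(n,t)$ ($n\in\mathbb Z$, $t\in\mathbb N$) be the amplitudes of the Hadamard walk on $\mathbb Z$ started at the origin in state $|R\rangle$: $\psi_R(0,0)=1$, all other amplitudes at time $0$ vanish, and $$\psi_L(n,t+1)=\tfrac1{\sqrt2}\bigl(\psi_R(n+1,t)-\psi_L(n+1,t)\bigr),\qquad \psi_R(n,t+1)=\tfrac1{\sqrt2}\bigl(\psi_R(n-1,t)+\psi_L(n-1,t)\bigr)$$ (apply the coin $|R\rangle\mapsto(|R\rangle+|L\rangle)/\sqrt2$, $|L\rangle\mapsto(|R\rangle-|L\rangle)/\sqrt2$, then move according to the new state). For $|\alpha|<1/\sqrt2$ put $$\theta=\arccos\Bigl(-\frac{\alpha^2}{1-\alpha^2}\Bigr)\in[\pi/2,\pi),\qquad \omega=\arctan\frac{\alpha}{\sqrt{1-2\alpha^2}},\qquad \rho=\frac{\theta}{1-\alpha}-\frac{2\alpha}{1-\alpha}\,\omega,$$ $$\xi_L=\frac{\theta}{1-\alpha}+\frac\pi4-\frac{1+\alpha}{1-\alpha}\,\omega,\qquad \xi_R=\xi_L-\frac\pi2+\omega,$$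 and $\varphi_{L}=\bigl(\tfrac{1-\alpha}{2}t-1\bigr)\rho+\xi_{L}$, $\varphi_{R}=\bigl(\tfrac{1-\alpha}{2}t-1\bigr)\rho+\xi_{R}$. Fix $\varepsilon>0$. Then, as $t\to\infty$, uniformly over all integers $n\equiv t \pmod 2$ such that $\alpha=n/t$ satisfies $|\alpha|<1/\sqrt2-\varepsilon$, $$\psi_R(n,t)=(-1)^{\frac{t-n}2+1}\Bigl(\frac{1+\alpha}{1-\alpha}\Bigr)^{1/2}\frac{\sqrt2}{(\pi t\sqrt{1-2\alpha^2})^{1/2}}\,\bigl(\sin\varphi_R+O(1/t)\bigr),$$ $$\psi_L(n,t)=(-1)^{\frac{t-n}2+1}\frac{\sqrt2}{(\pi t\sqrt{1-2\alpha^2})^{1/2}}\,\bigl(\sin\varphi_L+O(1/t)\bigr),$$ where the constants in the $O$-terms depend only on $\varepsilon$. Consequently, for every $\delta>0$, $\sin\varphi_R+O(1/t)$ may be replaced by $\sin\varphi_R\cdot(1+O(1/t))$ uniformly over those $(n,t)$ with $|\sin\varphi_R|\ge\delta$, and likewise $\sin\varphi_L+O(1/t)$ by $\sin\varphi_L\cdot(1+O(1/t))$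 where $|\sin\varphi_L|\ge\delta$ (constants depending only on $\varepsilon$ and $\delta$). -/

import Mathlib

namespace HadamardWalk

/-- The Hadamard coin on a pair of amplitudes, listed as (left, right):
`|R⟩ ↦ (|R⟩ + |L⟩)/√2` and `|L⟩ ↦ (|R⟩ - |L⟩)/√2`. -/
noncomputable def coin (v : ℝ × ℝ) : ℝ × ℝ :=
  ((v.2 - v.1) / √2, (v.2 + v.1) / √2)

/-- The wave function of the walk that starts at the origin in the state `|R⟩`.
`wave t n` is the pair (left amplitude, right amplitude) at position `n` after `t` steps.
In each step the coin is applied at every site, then the left component moves one site to the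
left and the right component one site to the right.  All amplitudes are real. -/
noncomputable def wave : ℕ → ℤ → ℝ × ℝ
  | 0, n => if n = 0 then (0, 1) else (0, 0)
  | t + 1, n => ((coin (wave t (n + 1))).1, (coin (wave t (n - 1))).2)

/-- The left amplitude at position `n` and time `t`. -/
noncomputable def psiL (n : ℤ) (t : ℕ) : ℝ := (wave t n).1

/-- The right amplitude at position `n` and time `t`. -/
noncomputable def psiR (n : ℤ) (t : ℕ) : ℝ := (wave t n).2

/-- `θ = arccos (-α² / (1 - α²))`. -/
noncomputable def theta (α : ℝ) : ℝ := Real.arccos (-α ^ 2 / (1 - α ^ 2))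

/-- The phase function `ρ`. -/
noncomputable def rho (α : ℝ) : ℝ :=
  theta α / (1 - α) - 2 * α / (1 - α) * Real.arctan (α / √(1 - 2 * α ^ 2))

/-- The phase function `ξ_L`. -/
noncomputable def xiL (α : ℝ) : ℝ :=
  theta α / (1 - α) + Real.pi / 4
    - (1 + α) / (1 - α) * Real.arctan (α / √(1 - 2 * α ^ 2))

/-- The phase function `ξ_R`. -/
noncomputable def xiR (α : ℝ) : ℝ :=
  xiL α - Real.pi / 2 + Real.arctan (α / √(1 - 2 * α ^ 2))

/-- The argument of the sine for the left amplitude. -/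
noncomputable def phaseL (α : ℝ) (t : ℕ) : ℝ := ((1 - α) / 2 * t - 1) * rho α + xiL α

/-- The argument of the sine for the right amplitude. -/
noncomputable def phaseR (α : ℝ) (t : ℕ) : ℝ := ((1 - α) / 2 * t - 1) * rho α + xiR α

/-- The amplitude of the oscillation of the left component. -/
noncomputable def ampL (α : ℝ) (t : ℕ) : ℝ := √2 / √(Real.pi * t * √(1 - 2 * α ^ 2))

/-- The amplitude of the oscillation of the right component. -/
noncomputable def ampR (α : ℝ) (t : ℕ) : ℝ := √((1 + α) / (1 - α)) * ampL α t

/-- The external sign `(-1)^((t - n)/2 + 1)`, used for `n` and `t` of the same parity. -/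
noncomputable def extSign (n : ℤ) (t : ℕ) : ℝ := (-1 : ℝ) ^ (((t : ℤ) - n) / 2 + 1)

end HadamardWalk

/-!
The left and right amplitudes after `k + 1` steps to the left and `B` steps to the right are, up to
the factor `√2 ^ (-t)`, the coefficients of `w ^ B` in `w ^ σ (w - 1) ^ k (w + 1) ^ B` with `σ = 0`
and `σ = 1` (`wave_eq_coeff`). By Cauchy's formula such a coefficient is an integral over a
circle, and since the polynomial is real, `π` times the coefficient is the real part of the integral
over the upper half circle (`re_integral_polynomial_circle`).

The exponent `a log (w - 1) + b log ((w + 1) / w)`, `a = (1 - α) / 2`, `b = (1 + α) / 2`, has two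
conjugate saddle points. On the circle through them, of radius `√((1 + α) / (1 - α))`, the modulus
of the integrand is largest exactly at the saddle points, with a Gaussian bound that holds on the
whole upper half circle (`norm_saddleQuotient_le`). The walk is therefore governed by Laplace's method
(`laplace_integral`) and no stationary phase estimate is needed: the linear and cubic
corrections to the Gaussian are odd and integrate to zero, and the rest is `O(t ^ (-3/2))`, one
factor `1 / t` below the main term. All bounds depend only on a positive lower bound for
`1 - 2 α ^ 2`.

At the saddle point everything is explicit: the integrand has modulus `√2 ^ (t - 1)`, times the
radius if `σ = 1`; its argument is linear in `θ / 2` and `ω`, up to a sign `(-1) ^ k`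
(`saddle_value_eq`), and the complex Gaussian integral contributes `2 √(π / (t √(1 - 2 α ^ 2)))` and the argument `π / 4 - θ / 2`
(`gaussian_factor_eq`). The sum of these arguments is `π / 2 - phaseL` or `π / 2 - phaseR`.
-/

/-! ### Laplace's method with an `O(t ^ (-3/2))` remainder -/

section Laplace

open MeasureTheory

/-- The second order remainder of `exp` at `v`. The estimate needs no bound on `u - v`, because the
moduli of `exp u` and `exp v` are controlled separately. -/
theorem norm_exp_sub_exp_sub_mul_exp_le {u v : ℂ} {E K : ℝ} (hK : 0 ≤ K)
    (hu : ‖Complex.exp u‖ ≤ K * E) (hv : ‖Complex.exp v‖ ≤ E) :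
    ‖Complex.exp u - Complex.exp v - (u - v) * Complex.exp v‖ ≤ (K + 2) * ‖u - v‖ ^ 2 * E := by
  have hE : 0 ≤ E := (norm_nonneg _).trans hv
  rcases le_total ‖u - v‖ 1 with h | h
  · have h1 : Complex.exp u - Complex.exp v - (u - v) * Complex.exp v
        = (Complex.exp (u - v) - 1 - (u - v)) * Complex.exp v := by
      rw [Complex.exp_sub]
      field_simp [Complex.exp_ne_zero v]
    rw [h1, norm_mul]
    calc _ ≤ ‖u - v‖ ^ 2 * E := by
          gcongr
          exact Complex.norm_exp_sub_one_sub_id_le h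
      _ ≤ _ := by
          have : 0 ≤ ‖u - v‖ ^ 2 * E := by positivity
          nlinarith
  · calc _ ≤ ‖Complex.exp u‖ + ‖Complex.exp v‖ + ‖u - v‖ * ‖Complex.exp v‖ := by
          refine (norm_sub_le _ _).trans ?_
          rw [norm_mul]
          gcongr
          exact norm_sub_le _ _
      _ ≤ K * E + E + ‖u - v‖ * E := by gcongr
      _ = (K + 1 + ‖u - v‖) * E := by ring
      _ ≤ _ := by
          gcongr
          have : 1 ≤ ‖u - v‖ ^ 2 := by nlinarith
          nlinarith

/-- Polynomial factors are absorbed by half of the exponential decay. -/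
theorem one_add_pow_three_mul_exp_le {c x : ℝ} (hc : 0 < c) (hx : 0 ≤ x) :
    (1 + x) ^ 3 * Real.exp (-(c * x)) ≤ (1 + 6 / c) ^ 3 * Real.exp (-(c / 2 * x)) := by
  have h1 : 1 + x ≤ (1 + 6 / c) * Real.exp (c * x / 6) := by
    have := Real.add_one_le_exp (c * x / 6)
    calc 1 + x ≤ (1 + 6 / c) * (c * x / 6 + 1) := by
          have : (1 + 6 / c) * (c * x / 6 + 1) = 1 + x + (c * x / 6 + 6 / c) := by
            field_simp; ring
          rw [this]
          have : 0 ≤ c * x / 6 + 6 / c := by positivity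
          linarith
      _ ≤ _ := by gcongr
  calc (1 + x) ^ 3 * Real.exp (-(c * x))
      ≤ ((1 + 6 / c) * Real.exp (c * x / 6)) ^ 3 * Real.exp (-(c * x)) := by gcongr
    _ = _ := by
        rw [mul_pow, ← Real.exp_nat_mul, mul_assoc, ← Real.exp_add]
        congr 2
        push_cast
        ring

theorem norm_exp_neg_mul_sq_le {b : ℂ} {t c s : ℝ} (ht : 0 ≤ t) (hb : c ≤ b.re) :
    ‖Complex.exp (-(t * b) * s ^ 2)‖ ≤ Real.exp (-(c * (t * s ^ 2))) := by
  rw [Complex.norm_exp, Real.exp_le_exp]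
  have : (-(t * b) * (s : ℂ) ^ 2).re = -(b.re * (t * s ^ 2)) := by
    rw [show -(t * b) * (s : ℂ) ^ 2 = ((-(t * s ^ 2) : ℝ) : ℂ) * b by push_cast; ring,
      Complex.re_ofReal_mul]
    ring
  rw [this]
  have : 0 ≤ t * s ^ 2 := by positivity
  nlinarith

/-- The pointwise estimate behind `laplace_integral`: a quantity `g` with a Gaussian bound, equal to
`exp (-t b s² + l s + t h s³ + O(s² + t s⁴))` for small `s`, differs from
`(1 + l s + t h s³) exp (-t b s²)` by `O(1 / t)` times a Gaussian, for all real `s`. -/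
theorem laplace_pointwise {c η K : ℝ} (hc : 0 < c) (hη : 0 < η) (hK : 0 ≤ K) :
    ∃ M : ℝ, 0 ≤ M ∧ ∀ (t : ℝ), 1 ≤ t → ∀ (g b l h : ℂ) (s : ℝ), c ≤ b.re → ‖l‖ ≤ K → ‖h‖ ≤ K →
      ‖g‖ ≤ K * Real.exp (-(c * (t * s ^ 2))) →
      (|s| ≤ η → ∃ u : ℂ, g = Complex.exp u ∧
        ‖u - (-(t * b) * s ^ 2 + (l * s + t * h * s ^ 3))‖ ≤ K * (s ^ 2 + t * s ^ 4)) →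
      ‖g - (1 + (l * s + t * h * s ^ 3)) * Complex.exp (-(t * b) * s ^ 2)‖ ≤
        M / t * Real.exp (-(c / 2 * t) * s ^ 2) := by
  set M₀ : ℝ := (K + 2) * K ^ 2 * (1 + η) ^ 2 + K + (K + 1) / η ^ 2 + 2 * K / η with hM₀
  refine ⟨M₀ * (1 + 6 / c) ^ 3, by positivity, ?_⟩
  intro t ht g b l h s hb hl hh hg hu
  have ht0 : 0 < t := by linarith
  set a := |s| with ha
  have ha0 : 0 ≤ a := abs_nonneg s
  have hsa : s ^ 2 = a ^ 2 := (sq_abs s).symm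
  have hns : ‖(s : ℂ)‖ = a := by rw [Complex.norm_real, Real.norm_eq_abs]
  -- In terms of `x = t s²` every error term below is `1 / t` times a polynomial in `x`.
  set x := t * s ^ 2 with hx
  have hx0 : 0 ≤ x := by positivity
  have hxa : x = t * a ^ 2 := by rw [hx, hsa]
  set E := Real.exp (-(c * x)) with hE
  have hE0 : 0 ≤ E := (Real.exp_pos _).le
  have hv := norm_exp_neg_mul_sq_le (s := s) ht0.le hb
  set v : ℂ := -(t * b) * s ^ 2 with hvdef
  have hodd : ‖l * s + t * h * s ^ 3‖ ≤ K * (a + t * a ^ 3) := by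
    refine (norm_add_le _ _).trans ?_
    rw [norm_mul, norm_mul, norm_mul, norm_pow, hns, Complex.norm_real, Real.norm_eq_abs,
      abs_of_pos ht0, mul_add]
    have h1 : ‖l‖ * a ≤ K * a := by gcongr
    have h2 : t * ‖h‖ * a ^ 3 ≤ t * K * a ^ 3 := by gcongr
    linarith
  have key : ‖g - (1 + (l * s + t * h * s ^ 3)) * Complex.exp v‖ ≤
      M₀ / t * ((1 + x) ^ 3 * E) := by
    have hpoly : x + x ^ 2 ≤ (1 + x) ^ 3 := by nlinarith [pow_nonneg hx0 3, pow_nonneg hx0 2]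
    have hpoly' : x * (1 + x) ^ 2 ≤ (1 + x) ^ 3 := by nlinarith [pow_nonneg hx0 3, pow_nonneg hx0 2]
    rcases le_total a η with hle | hge
    · obtain ⟨u, hgu, hu⟩ := hu hle
      have hs4 : s ^ 2 + t * s ^ 4 = (x + x ^ 2) / t := by
        rw [hx]; field_simp
      have hd : ‖u - v‖ ≤ K * (1 + η) * (a * (1 + x)) := by
        have h1 : ‖u - v‖ ≤ ‖u - (v + (l * s + t * h * s ^ 3))‖ + ‖l * s + t * h * s ^ 3‖ := by
          refine le_trans (le_of_eq ?_) (norm_add_le _ _)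
          congr 1; ring
        have h2 : K * (s ^ 2 + t * s ^ 4) ≤ K * η * (a * (1 + x)) := by
          have : s ^ 2 + t * s ^ 4 = a * (a * (1 + x)) := by
            rw [hx, show s ^ 4 = s ^ 2 * s ^ 2 by ring, hsa]; ring
          rw [this, mul_assoc]
          gcongr
        have h3 : a + t * a ^ 3 = a * (1 + x) := by rw [hxa]; ring
        rw [h3] at hodd
        linarith
      have hd2 : ‖u - v‖ ^ 2 ≤ K ^ 2 * (1 + η) ^ 2 * (x * (1 + x) ^ 2 / t) := by
        calc _ ≤ (K * (1 + η) * (a * (1 + x))) ^ 2 := by gcongr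
          _ = _ := by rw [hxa]; field_simp
      have h1 := norm_exp_sub_exp_sub_mul_exp_le (E := E) hK (hgu ▸ hg) hv
      have h2 : g - (1 + (l * s + t * h * s ^ 3)) * Complex.exp v
          = (Complex.exp u - Complex.exp v - (u - v) * Complex.exp v)
            + (u - (v + (l * s + t * h * s ^ 3))) * Complex.exp v := by rw [hgu]; ring
      rw [h2]
      calc _ ≤ (K + 2) * ‖u - v‖ ^ 2 * E + K * (s ^ 2 + t * s ^ 4) * E := by
            refine (norm_add_le _ _).trans (add_le_add h1 ?_)
            rw [norm_mul]
            gcongr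
        _ ≤ (K + 2) * (K ^ 2 * (1 + η) ^ 2 * ((1 + x) ^ 3 / t)) * E
              + K * ((1 + x) ^ 3 / t) * E := by
            rw [hs4]
            have : x * (1 + x) ^ 2 / t ≤ (1 + x) ^ 3 / t := by gcongr
            gcongr
            exact hd2.trans (by gcongr)
        _ = ((K + 2) * K ^ 2 * (1 + η) ^ 2 + K) / t * ((1 + x) ^ 3 * E) := by ring
        _ ≤ _ := by
            gcongr
            have : 0 ≤ (K + 1) / η ^ 2 + 2 * K / η := by positivity
            rw [hM₀]; linarith
    · -- Away from `0` all terms are individually small, as `1 ≤ s² / η²`.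
      have h1 : (1 : ℝ) ≤ x / t / η ^ 2 := by
        rw [hxa, mul_div_cancel_left₀ _ ht0.ne', one_le_div (by positivity)]
        gcongr
      have h2 : a + t * a ^ 3 ≤ (x + x ^ 2) / t / η := by
        rw [le_div_iff₀ hη, hxa]
        have : (t * a ^ 2 + (t * a ^ 2) ^ 2) / t = (a + t * a ^ 3) * a := by field_simp
        rw [this]
        gcongr
      calc _ ≤ ‖g‖ + (1 + ‖l * s + t * h * s ^ 3‖) * ‖Complex.exp v‖ := by
            refine (norm_sub_le _ _).trans ?_
            rw [norm_mul]
            gcongr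
            refine (norm_add_le _ _).trans ?_
            simp
        _ ≤ K * E + (1 + K * (a + t * a ^ 3)) * E := by gcongr
        _ = ((K + 1) * 1 + K * (a + t * a ^ 3)) * E := by ring
        _ ≤ ((K + 1) * (x / t / η ^ 2) + K * ((x + x ^ 2) / t / η)) * E := by gcongr
        _ ≤ ((K + 1) * ((1 + x) ^ 3 / t / η ^ 2) + K * ((1 + x) ^ 3 / t / η)) * E := by
            have : x ≤ (1 + x) ^ 3 := by nlinarith
            gcongr
        _ = ((K + 1) / η ^ 2 + K / η) / t * ((1 + x) ^ 3 * E) := by field_simp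
        _ ≤ _ := by
            gcongr
            have h3 : 0 ≤ (K + 2) * K ^ 2 * (1 + η) ^ 2 := by positivity
            have h4 : 0 ≤ K / η := by positivity
            rw [hM₀, mul_div_assoc]; linarith
  refine key.trans ?_
  rw [show -(c / 2 * t) * s ^ 2 = -(c / 2 * x) by rw [hx]; ring]
  calc _ ≤ M₀ / t * ((1 + 6 / c) ^ 3 * Real.exp (-(c / 2 * x))) := by
        exact mul_le_mul_of_nonneg_left (one_add_pow_three_mul_exp_le hc hx0) (by positivity)
    _ = _ := by ring

theorem integrable_odd_mul_gaussian {b : ℂ} (hb : 0 < b.re) (l h : ℂ) :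
    Integrable fun s : ℝ => (l * s + h * s ^ 3) * Complex.exp (-b * s ^ 2) := by
  have h1 : Integrable fun s : ℝ => (s : ℂ) * Complex.exp (-b * s ^ 2) :=
    integrable_mul_cexp_neg_mul_sq hb
  have h3 : Integrable fun s : ℝ => (s : ℂ) ^ 3 * Complex.exp (-b * s ^ 2) := by
    have h := (integrable_rpow_mul_exp_neg_mul_sq hb (s := 3) (by norm_num)).norm
    refine h.mono' (by fun_prop) (Filter.Eventually.of_forall fun s => le_of_eq ?_)
    rw [norm_mul, norm_mul, norm_cexp_neg_mul_sq, ← Complex.ofReal_pow, Complex.norm_real]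
    norm_num
  refine ((h1.const_mul l).add (h3.const_mul h)).congr (Filter.Eventually.of_forall fun s => ?_)
  simp only [Pi.add_apply]
  ring

theorem integral_odd_mul_gaussian (b l h : ℂ) :
    ∫ s : ℝ, (l * s + h * s ^ 3) * Complex.exp (-b * s ^ 2) = 0 := by
  have h1 := integral_neg_eq_self
    (fun s : ℝ => (l * s + h * s ^ 3) * Complex.exp (-b * s ^ 2)) volume
  have h2 : (fun s : ℝ => (l * ((-s : ℝ) : ℂ) + h * ((-s : ℝ) : ℂ) ^ 3) *
      Complex.exp (-b * ((-s : ℝ) : ℂ) ^ 2))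
      = fun s : ℝ => -((l * s + h * s ^ 3) * Complex.exp (-b * s ^ 2)) := by
    funext s
    push_cast
    rw [neg_sq]
    ring
  rw [h2, integral_neg] at h1
  exact self_eq_neg.mp h1.symm

/-- Laplace's method on a set containing `[-η, η]`, with a complex quadratic coefficient `b`. The
odd corrections `l s` and `t h s³` do not contribute, so that the error is `O(t ^ (-3/2))`; the
constant depends only on `c`, `η` and `K`. -/
theorem laplace_integral {c η K : ℝ} (hc : 0 < c) (hη : 0 < η) (hK : 0 ≤ K) :
    ∃ C : ℝ, 0 ≤ C ∧ ∀ (t : ℝ), 1 ≤ t → ∀ (G : ℝ → ℂ) (I : Set ℝ) (b l h : ℂ),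
      MeasurableSet I → IntegrableOn G I → Set.Icc (-η) η ⊆ I →
      c ≤ b.re → ‖l‖ ≤ K → ‖h‖ ≤ K →
      (∀ s ∈ I, ‖G s‖ ≤ K * Real.exp (-(c * (t * s ^ 2)))) →
      (∀ s : ℝ, |s| ≤ η → ∃ u : ℂ, G s = Complex.exp u ∧
        ‖u - (-(t * b) * s ^ 2 + (l * s + t * h * s ^ 3))‖ ≤ K * (s ^ 2 + t * s ^ 4)) →
      ‖(∫ s in I, G s) - (Real.pi / (t * b)) ^ (1 / 2 : ℂ)‖ ≤ C / (t * √t) := by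
  obtain ⟨M, hM0, hM⟩ := laplace_pointwise hc hη hK
  refine ⟨M * √(Real.pi / (c / 2)), by positivity, ?_⟩
  intro t ht G I b l h hI hGI hηI hb hl hh hG hu
  have ht0 : 0 < t := by linarith
  have hre : 0 < (t * b).re := by
    rw [Complex.re_ofReal_mul]
    have : 0 < b.re := by linarith
    positivity
  have hpt : ∀ s : ℝ, ‖I.indicator G s -
      (Complex.exp (-(t * b) * s ^ 2) + (l * s + t * h * s ^ 3) * Complex.exp (-(t * b) * s ^ 2))‖
      ≤ M / t * Real.exp (-(c / 2 * t) * s ^ 2) := by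
    intro s
    have := hM t ht (I.indicator G s) b l h s hb hl hh ?_ ?_
    · rwa [add_mul, one_mul] at this
    · by_cases hs : s ∈ I
      · rw [Set.indicator_of_mem hs]; exact hG s hs
      · rw [Set.indicator_of_notMem hs, norm_zero]; positivity
    · intro hs
      rw [Set.indicator_of_mem (hηI (abs_le.mp hs))]
      exact hu s hs
  have i1 : Integrable fun s : ℝ => Complex.exp (-(t * b) * s ^ 2) := integrable_cexp_neg_mul_sq hre
  have i2 := integrable_odd_mul_gaussian hre l (t * h)
  have i0 : Integrable (I.indicator G) := (integrable_indicator_iff hI).mpr hGI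
  have e1 : ∫ s : ℝ, (I.indicator G s -
      (Complex.exp (-(t * b) * s ^ 2) + (l * s + t * h * s ^ 3) * Complex.exp (-(t * b) * s ^ 2)))
      = (∫ s in I, G s) - (Real.pi / (t * b)) ^ (1 / 2 : ℂ) := by
    rw [integral_sub i0 (by exact i1.add i2), integral_indicator hI, integral_add i1 i2,
      integral_odd_mul_gaussian, add_zero, integral_gaussian_complex hre]
  rw [← e1]
  have hct : 0 < c / 2 * t := by positivity
  calc _ ≤ ∫ s : ℝ, M / t * Real.exp (-(c / 2 * t) * s ^ 2) :=
        norm_integral_le_of_norm_le ((integrable_exp_neg_mul_sq hct).const_mul _)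
          (Filter.Eventually.of_forall hpt)
    _ = _ := by
        rw [integral_const_mul, integral_gaussian, ← div_div, Real.sqrt_div (by positivity)]
        have : 0 < √t := by positivity
        field_simp

end Laplace

/-! ### Taylor expansion of the logarithm of the integrand -/

/-- Third order Taylor expansion of `log (1 + P (e^z - 1))` at `z = 0`, uniformly in `P`. -/
theorem norm_log_one_add_mul_exp_sub_one_sub_le {P z : ℂ} (hP : ‖P‖ ≤ 4) (hz : ‖z‖ ≤ 1 / 8)
    (hy : ‖Complex.exp z - 1‖ ≤ ‖z‖) :
    ‖Complex.log (1 + P * (Complex.exp z - 1)) -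
      (P * z + (P - P ^ 2) / 2 * z ^ 2 + (P / 6 - P ^ 2 / 2 + P ^ 3 / 3) * z ^ 3)‖
      ≤ 228 * ‖z‖ ^ 4 := by
  set y := Complex.exp z - 1 with hydef
  have hz0 := norm_nonneg z
  have hexp : ‖y - (z + z ^ 2 / 2 + z ^ 3 / 6)‖ ≤ ‖z‖ ^ 4 := by
    have h := Complex.exp_bound (x := z) (by linarith) (n := 4) (by norm_num)
    simp only [Finset.sum_range_succ, Finset.sum_range_zero, Nat.factorial] at h
    have e : y - (z + z ^ 2 / 2 + z ^ 3 / 6) = Complex.exp z -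
        (0 + z ^ 0 / ((1 : ℕ) : ℂ) + z ^ 1 / (((0 + 1) * 1 : ℕ) : ℂ)
          + z ^ 2 / (((1 + 1) * ((0 + 1) * 1) : ℕ) : ℂ)
          + z ^ 3 / (((2 + 1) * ((1 + 1) * ((0 + 1) * 1)) : ℕ) : ℂ)) := by
      rw [hydef]; push_cast; ring
    rw [e]
    refine h.trans ?_
    have : 0 ≤ ‖z‖ ^ 4 := by positivity
    norm_num
    linarith
  set e1 := y - (z + z ^ 2 / 2 + z ^ 3 / 6) with he1
  have hPy : ‖P * y‖ ≤ 4 * ‖z‖ := by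
    rw [norm_mul]; gcongr
  have hlog : ‖Complex.log (1 + P * y) - (P * y - (P * y) ^ 2 / 2 + (P * y) ^ 3 / 3)‖
      ≤ 128 * ‖z‖ ^ 4 := by
    have h := Complex.norm_log_sub_logTaylor_le 3 (z := P * y) (by linarith)
    have e : Complex.logTaylor (3 + 1) (P * y) = P * y - (P * y) ^ 2 / 2 + (P * y) ^ 3 / 3 := by
      simp only [Complex.logTaylor_succ, Complex.logTaylor_zero, Pi.add_apply]
      push_cast
      ring
    rw [e] at h
    refine h.trans ?_
    have h2 : (1 - ‖P * y‖)⁻¹ ≤ 2 := by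
      rw [inv_le_comm₀ (by linarith) (by norm_num)]
      linarith
    have h3 : 0 ≤ (1 - ‖P * y‖)⁻¹ := inv_nonneg.mpr (by linarith)
    calc ‖P * y‖ ^ (3 + 1) * (1 - ‖P * y‖)⁻¹ / ((3 : ℕ) + 1)
        ≤ (4 * ‖z‖) ^ (3 + 1) * 2 / ((3 : ℕ) + 1) := by gcongr
      _ = _ := by push_cast; ring
  have hy1 : ‖y - z‖ ≤ ‖z‖ ^ 2 := by
    have : y - z = z ^ 2 / 2 + z ^ 3 / 6 + e1 := by rw [he1]; ring
    rw [this]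
    have a := norm_add₃_le (a := z ^ 2 / 2) (b := z ^ 3 / 6) (c := e1)
    simp only [norm_div, norm_pow, Complex.norm_ofNat] at a
    have b1 : ‖z‖ ^ 3 ≤ ‖z‖ ^ 2 * (1 / 8) := by rw [pow_succ]; gcongr
    have b2 : ‖z‖ ^ 4 ≤ ‖z‖ ^ 2 * (1 / 8) ^ 2 := by
      rw [show ‖z‖ ^ 4 = ‖z‖ ^ 2 * ‖z‖ ^ 2 by ring]; gcongr
    nlinarith [sq_nonneg ‖z‖]
  have hy2 : ‖y ^ 2 - (z ^ 2 + z ^ 3)‖ ≤ 4 * ‖z‖ ^ 4 := by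
    have : y ^ 2 - (z ^ 2 + z ^ 3) = (y - z) ^ 2 + 2 * z * (z ^ 3 / 6 + e1) := by
      rw [he1]; ring
    rw [this]
    calc _ ≤ (‖z‖ ^ 2) ^ 2 + 2 * ‖z‖ * (‖z‖ ^ 3 / 6 + ‖z‖ ^ 4) := by
          refine (norm_add_le _ _).trans (add_le_add ?_ ?_)
          · rw [norm_pow]; gcongr
          · rw [norm_mul, norm_mul, Complex.norm_ofNat]
            gcongr
            refine (norm_add_le _ _).trans (add_le_add (le_of_eq ?_) hexp)
            simp
      _ ≤ (‖z‖ ^ 2) ^ 2 + 2 * ‖z‖ * (‖z‖ ^ 3 / 6 + ‖z‖ ^ 3 * (1 / 8)) := by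
          rw [show ‖z‖ ^ 4 = ‖z‖ ^ 3 * ‖z‖ by ring]; gcongr
      _ ≤ _ := by nlinarith [pow_nonneg hz0 4]
  have hy3 : ‖y ^ 3 - z ^ 3‖ ≤ 3 * ‖z‖ ^ 4 := by
    have : y ^ 3 - z ^ 3 = (y - z) * (y ^ 2 + y * z + z ^ 2) := by ring
    rw [this, norm_mul]
    calc _ ≤ ‖z‖ ^ 2 * (‖z‖ ^ 2 + ‖z‖ * ‖z‖ + ‖z‖ ^ 2) := by
          gcongr
          refine norm_add₃_le.trans ?_
          rw [norm_pow, norm_mul, norm_pow]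
          gcongr
      _ = _ := by ring
  have hsum : Complex.log (1 + P * y) -
      (P * z + (P - P ^ 2) / 2 * z ^ 2 + (P / 6 - P ^ 2 / 2 + P ^ 3 / 3) * z ^ 3)
      = (Complex.log (1 + P * y) - (P * y - (P * y) ^ 2 / 2 + (P * y) ^ 3 / 3))
        + P * e1 + (-(P ^ 2 / 2) * (y ^ 2 - (z ^ 2 + z ^ 3)) + P ^ 3 / 3 * (y ^ 3 - z ^ 3)) := by
    rw [he1]; ring
  rw [hsum]
  calc _ ≤ 128 * ‖z‖ ^ 4 + 4 * ‖z‖ ^ 4 +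
        (4 ^ 2 / 2 * (4 * ‖z‖ ^ 4) + 4 ^ 3 / 3 * (3 * ‖z‖ ^ 4)) := by
        refine norm_add₃_le.trans (add_le_add (add_le_add hlog ?_) ?_)
        · rw [norm_mul]; gcongr
        · refine (norm_add_le _ _).trans (add_le_add ?_ ?_)
          · rw [norm_mul, norm_neg, norm_div, norm_pow, Complex.norm_ofNat]; gcongr
          · rw [norm_mul, norm_div, norm_pow, Complex.norm_ofNat]; gcongr
    _ = _ := by ring

/-! ### Coefficients as integrals over a half circle -/

section Coefficients

open MeasureTheory Polynomial

theorem re_integral_zpow_circle (r : ℝ) (k : ℤ) :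
    (∫ τ in (0 : ℝ)..Real.pi, ((r : ℂ) * Complex.exp (τ * Complex.I)) ^ k).re
      = if k = 0 then Real.pi else 0 := by
  have h1 : ∀ τ : ℝ, (((r : ℂ) * Complex.exp (τ * Complex.I)) ^ k)
      = ((r ^ k * Real.cos (k * τ) : ℝ) : ℂ)
        + ((r ^ k * Real.sin (k * τ) : ℝ) : ℂ) * Complex.I := by
    intro τ
    rw [mul_zpow, ← Complex.exp_int_mul,
      show (k : ℂ) * (τ * Complex.I) = ((k * τ : ℝ) : ℂ) * Complex.I by push_cast; ring,
      Complex.exp_mul_I]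
    push_cast
    ring
  have hint : IntervalIntegrable (fun τ : ℝ => ((r : ℂ) * Complex.exp (τ * Complex.I)) ^ k)
      volume 0 Real.pi := by
    apply Continuous.intervalIntegrable
    simp_rw [h1]
    fun_prop
  have h2 := Complex.reCLM.intervalIntegral_comp_comm hint
  simp only [Complex.reCLM_apply] at h2
  rw [← h2]
  have h3 : ∀ τ : ℝ,
      (((r : ℂ) * Complex.exp (τ * Complex.I)) ^ k).re = r ^ k * Real.cos (k * τ) := by
    intro τ
    rw [h1, Complex.add_re, Complex.ofReal_re, Complex.re_ofReal_mul, Complex.I_re, mul_zero,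
      add_zero]
  simp_rw [h3]
  rw [intervalIntegral.integral_const_mul]
  split_ifs with hk
  · simp [hk]
  · have hk' : (k : ℝ) ≠ 0 := by exact_mod_cast hk
    rw [intervalIntegral.integral_comp_mul_left _ hk', integral_cos]
    simp [Real.sin_int_mul_pi]

/-- Cauchy's formula for a coefficient of a real polynomial, on the upper half circle. -/
theorem re_integral_polynomial_circle {r : ℝ} (hr : 0 < r) (p : ℝ[X]) (m : ℕ) :
    (∫ τ in (0 : ℝ)..Real.pi, aeval ((r : ℂ) * Complex.exp (τ * Complex.I)) p *
      ((r : ℂ) * Complex.exp (τ * Complex.I)) ^ (-(m : ℤ))).re = Real.pi * p.coeff m := by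
  have hne : ∀ τ : ℝ, (r : ℂ) * Complex.exp (τ * Complex.I) ≠ 0 := fun τ =>
    mul_ne_zero (by exact_mod_cast hr.ne') (Complex.exp_ne_zero _)
  have hc : ∀ k : ℤ, Continuous fun τ : ℝ => ((r : ℂ) * Complex.exp (τ * Complex.I)) ^ k := by
    intro k
    exact Continuous.zpow₀ (by fun_prop) k fun τ => Or.inl (hne τ)
  induction p using Polynomial.induction_on' with
  | add p q hp hq =>
    simp only [map_add, add_mul, coeff_add, mul_add]
    rw [intervalIntegral.integral_add, Complex.add_re, hp, hq]
    all_goals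
      apply Continuous.intervalIntegrable
      refine Continuous.mul ?_ (hc _)
      simp only [aeval_def, ← eval_map]
      fun_prop
  | monomial n a =>
    have h1 : ∀ τ : ℝ, aeval ((r : ℂ) * Complex.exp (τ * Complex.I)) (monomial n a) *
        ((r : ℂ) * Complex.exp (τ * Complex.I)) ^ (-(m : ℤ))
        = (a : ℂ) * ((r : ℂ) * Complex.exp (τ * Complex.I)) ^ ((n : ℤ) - m) := by
      intro τ
      rw [aeval_monomial, sub_eq_add_neg, zpow_add₀ (hne τ), zpow_natCast, mul_assoc]
      rfl
    simp_rw [h1]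
    rw [intervalIntegral.integral_const_mul, Complex.re_ofReal_mul, re_integral_zpow_circle r,
      coeff_monomial]
    rcases eq_or_ne n m with h | h
    · simp [h, mul_comm]
    · have : (n : ℤ) - m ≠ 0 := by omega
      simp [h, this]

end Coefficients

/-! ### Real inequalities for the modulus of the integrand -/

theorem one_sub_le_exp_neg_add_sq {x : ℝ} (h0 : 0 ≤ x) (h1 : x ≤ 1) :
    1 - x ≤ Real.exp (-(x + x ^ 2 / 2)) := by
  rcases h1.eq_or_lt with rfl | h1
  · rw [sub_self]; positivity
  have h := Real.hasSum_pow_div_log_of_abs_lt_one (x := x) (by rwa [abs_of_nonneg h0])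
  have h2 := sum_le_hasSum (Finset.range 2) (fun i _ => by positivity) h
  simp only [Finset.sum_range_succ, Finset.sum_range_zero] at h2
  norm_num at h2
  rw [← Real.log_le_iff_le_exp (by linarith)]
  linarith

/-- On `[0, π]` the cosine moves away from its value at `y` at least linearly, with slope
`sin y / π`. -/
theorem sin_mul_abs_sub_div_pi_le {x y : ℝ} (hx : x ∈ Set.Icc 0 Real.pi)
    (hy : y ∈ Set.Icc 0 Real.pi) :
    Real.sin y * (|x - y| / Real.pi) ≤ |Real.cos x - Real.cos y| := by
  have hpi := Real.pi_pos
  have h1 : |x - y| / Real.pi ≤ |Real.sin ((x - y) / 2)| := by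
    have h := Real.mul_abs_le_abs_sin (x := (x - y) / 2) (by
      rw [abs_div, abs_two]
      have := abs_sub_le_of_nonneg_of_le hx.1 hx.2 hy.1 hy.2
      linarith)
    rw [abs_div, abs_two] at h
    refine le_trans (le_of_eq ?_) h
    field_simp
  have hsin : 0 ≤ Real.sin ((x + y) / 2) :=
    Real.sin_nonneg_of_nonneg_of_le_pi (by linarith [hx.1, hy.1]) (by linarith [hx.2, hy.2])
  have h2 : Real.sin y ≤ 2 * Real.sin ((x + y) / 2) := by
    have h := Real.sin_nonneg_of_nonneg_of_le_pi hx.1 hx.2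
    have h3 : Real.sin x + Real.sin y = 2 * Real.sin ((x + y) / 2) * Real.cos ((x - y) / 2) := by
      have e1 := Real.sin_add ((x + y) / 2) ((x - y) / 2)
      have e2 := Real.sin_sub ((x + y) / 2) ((x - y) / 2)
      rw [show (x + y) / 2 + (x - y) / 2 = x by ring] at e1
      rw [show (x + y) / 2 - (x - y) / 2 = y by ring] at e2
      rw [e1, e2]
      ring
    have h4 := Real.cos_le_one ((x - y) / 2)
    nlinarith
  rw [Real.cos_sub_cos, abs_mul, abs_mul, abs_neg, abs_two, abs_of_nonneg hsin]
  gcongr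

/-- Applied with `y = √(1 - α²) cos τ - α`, the two bases are the squared moduli of the factors of
the integrand on the circle through the saddle points, relative to their values there. The first
order terms in `y` cancel. -/
theorem pow_mul_pow_le_exp {α t y : ℝ} {k B : ℕ} (h1 : 0 < 1 - α) (h2 : 0 < 1 + α)
    (hA : (k : ℝ) + 1 = t * (1 - α) / 2) (hB : (B : ℝ) = t * (1 + α) / 2)
    (hp : 0 ≤ 1 - y / (1 - α)) (hq : 0 ≤ 1 + y / (1 + α)) :
    (1 - y / (1 - α)) ^ k * (1 + y / (1 + α)) ^ B ≤ Real.exp 2 * Real.exp (-(t * y ^ 2 / 8)) := by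
  have ht : 0 < t := by
    by_contra! h
    have : t * (1 - α) ≤ 0 := mul_nonpos_of_nonpos_of_nonneg h h1.le
    have : (0 : ℝ) ≤ k := Nat.cast_nonneg k
    linarith
  have hty : 0 ≤ t * y ^ 2 := by positivity
  -- Only the base below `1` is expanded to second order; this is enough for the Gaussian bound.
  rcases le_total 0 y with hy | hy
  · set x := y / (1 - α) with hx
    have hx0 : 0 ≤ x := by positivity
    have hyx : y = x * (1 - α) := by rw [hx]; field_simp
    calc _ ≤ (Real.exp (-(x + x ^ 2 / 2))) ^ k * (Real.exp (y / (1 + α))) ^ B := by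
          have := one_sub_le_exp_neg_add_sq hx0 (by linarith)
          have := Real.add_one_le_exp (y / (1 + α))
          rw [add_comm] at this
          gcongr
      _ = Real.exp (x + x ^ 2 / 2 - t * y * x / 4) := by
          rw [← Real.exp_nat_mul, ← Real.exp_nat_mul, ← Real.exp_add]
          congr 1
          rw [show (k : ℝ) = t * (1 - α) / 2 - 1 by linarith, hB, mul_div_assoc', hyx]
          field_simp
          ring
      _ ≤ _ := by
          rw [← Real.exp_add, Real.exp_le_exp]
          have : y * y ≤ 2 * (y * x) := by
            rw [hyx]
            have : 0 ≤ x ^ 2 * (1 - α) * (1 + α) := by positivity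
            nlinarith
          nlinarith
  · set x := -y / (1 + α) with hx
    have hx0 : 0 ≤ x := div_nonneg (by linarith) h2.le
    have hyx : y = -(x * (1 + α)) := by rw [hx]; field_simp
    have hxq : 1 + y / (1 + α) = 1 - x := by rw [hx]; ring
    have hp1 : 1 ≤ 1 - y / (1 - α) := by
      have := div_nonpos_of_nonpos_of_nonneg hy h1.le
      linarith
    calc _ ≤ (Real.exp (-(y / (1 - α)))) ^ (k + 1) * (Real.exp (-(x + x ^ 2 / 2))) ^ B := by
          have a1 := one_sub_le_exp_neg_add_sq hx0 (by linarith)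
          have a2 := Real.add_one_le_exp (-(y / (1 - α)))
          have a3 : (1 - y / (1 - α)) ^ k ≤ (1 - y / (1 - α)) ^ (k + 1) :=
            pow_le_pow_right₀ hp1 (Nat.le_succ k)
          have a4 : (1 - y / (1 - α)) ^ (k + 1) ≤ (Real.exp (-(y / (1 - α)))) ^ (k + 1) := by
            gcongr
            linarith
          rw [hxq] at hq ⊢
          gcongr
          exact a3.trans a4
      _ = Real.exp (t * y * x / 4) := by
          rw [← Real.exp_nat_mul, ← Real.exp_nat_mul, ← Real.exp_add]
          congr 1
          push_cast
          rw [hA, hB, hyx]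
          field_simp
          ring
      _ ≤ _ := by
          rw [← Real.exp_add, Real.exp_le_exp]
          have : 2 * (y * x) ≤ -(y * y) := by
            rw [hyx]
            have : 0 ≤ x ^ 2 * (1 - α) * (1 + α) := by positivity
            nlinarith
          nlinarith

namespace HadamardWalk

/-! ### The amplitudes as polynomial coefficients -/

section Amplitudes

open Polynomial

theorem wave_eq_zero_of_lt (t : ℕ) (n : ℤ) (h : (t : ℤ) < |n|) : wave t n = (0, 0) := by
  induction t generalizing n with
  | zero =>
    have : n ≠ 0 := by rintro rfl; simp at h
    simp [wave, this]
  | succ t ih =>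
    push_cast at h
    rw [wave, ih (n + 1), ih (n - 1)]
    · simp [coin]
    · rcases abs_cases n with h1 | h1 <;> rcases abs_cases (n - 1) with h2 | h2 <;> omega
    · rcases abs_cases n with h1 | h1 <;> rcases abs_cases (n + 1) with h2 | h2 <;> omega

/-- `√2 ^ (A + B)` times the left amplitude after `A` steps to the left and `B` to the right. For
`A = 0` the coefficient formula does not apply and the value `0` is given separately. -/
noncomputable def leftCoeff (A B : ℕ) : ℝ :=
  if A = 0 then 0 else ((X - 1) ^ (A - 1) * (X + 1) ^ B : ℝ[X]).coeff B

/-- `√2 ^ (A + B)` times the right amplitude after `A` steps to the left and `B` to the right. For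
`A = 0` the walk has only moved to the right and the value is `1`. -/
noncomputable def rightCoeff (A B : ℕ) : ℝ :=
  if A = 0 then 1 else (X * ((X - 1) ^ (A - 1) * (X + 1) ^ B) : ℝ[X]).coeff B

theorem leftCoeff_succ (A B : ℕ) : leftCoeff (A + 1) B = rightCoeff A B - leftCoeff A B := by
  rcases A with _ | A
  · have : ((X + 1 : ℝ[X]) ^ B).coeff B = 1 := by
      rw [coeff_X_add_one_pow]; simp
    simp [leftCoeff, rightCoeff, this]
  · simp only [leftCoeff, rightCoeff, Nat.succ_ne_zero, if_false, Nat.add_sub_cancel]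
    rw [← coeff_sub]
    congr 1
    ring

theorem rightCoeff_succ (A B : ℕ) : rightCoeff A (B + 1) = rightCoeff A B + leftCoeff A B := by
  rcases A with _ | A
  · simp [leftCoeff, rightCoeff]
  · simp only [leftCoeff, rightCoeff, Nat.succ_ne_zero, if_false, Nat.add_sub_cancel]
    rw [coeff_X_mul, ← coeff_add]
    congr 1
    ring

theorem wave_eq_coeff (t A B : ℕ) (h : A + B = t) :
    wave t ((B : ℤ) - A) = (leftCoeff A B / √2 ^ t, rightCoeff A B / √2 ^ t) := by
  induction t generalizing A B with
  | zero =>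
    obtain ⟨rfl, rfl⟩ : A = 0 ∧ B = 0 := by omega
    simp [wave, leftCoeff, rightCoeff]
  | succ t ih =>
    have h2 : √2 ^ t ≠ 0 := by positivity
    have h3 : √2 ≠ 0 := by positivity
    rw [wave, Prod.mk.injEq]
    constructor
    · rcases A with _ | A
      · rw [wave_eq_zero_of_lt t]
        · simp [coin, leftCoeff]
        · rw [abs_of_nonneg] <;> omega
      · rw [show (B : ℤ) - (A + 1 : ℕ) + 1 = B - A by push_cast; ring, ih A B (by omega),
          leftCoeff_succ, coin]
        simp only
        rw [pow_succ]
        field_simp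
    · rcases B with _ | B
      · rw [wave_eq_zero_of_lt t]
        · have : A ≠ 0 := by omega
          simp [coin, rightCoeff, this]
        · rw [abs_of_nonpos] <;> omega
      · rw [show ((B + 1 : ℕ) : ℤ) - A - 1 = B - A by push_cast; ring, ih A B (by omega),
          rightCoeff_succ, coin]
        simp only
        rw [pow_succ]
        field_simp

end Amplitudes

open Complex (I)

/-! ### The saddle point -/

/-- The angle `ω` of the phase functions. The saddle point has argument `π / 2 - ω`. -/
noncomputable def omega (α : ℝ) : ℝ := Real.arctan (α / √(1 - 2 * α ^ 2))

/-- The saddle point of `w ↦ (w - 1)^a ((w + 1) / w)^b`, `a = (1 - α) / 2`, `b = (1 + α) / 2`,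
in the upper half plane. -/
noncomputable def saddle (α : ℝ) : ℂ := (α + √(1 - 2 * α ^ 2) * I) / (1 - α)

/-- The radius of the circle around `0` through the two saddle points. -/
noncomputable def saddleRadius (α : ℝ) : ℝ := √((1 + α) / (1 - α))

/-- `w₀ / (w₀ - 1)` at the saddle point `w₀`. -/
noncomputable def ratioP (α : ℝ) : ℂ := (1 - √(1 - 2 * α ^ 2) * I) / (2 * (1 - α))

/-- `1 / (w₀ + 1)` at the saddle point `w₀`. -/
noncomputable def ratioQ (α : ℝ) : ℂ := (1 - √(1 - 2 * α ^ 2) * I) / (2 * (1 + α))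

/-- The coefficient `b` in the expansion `-b s² + O(s³)` of the exponent, per unit of time, at the
saddle point. -/
noncomputable def curvature (α : ℝ) : ℂ :=
  √(1 - 2 * α ^ 2) * (√(1 - 2 * α ^ 2) + α ^ 2 * I) / (4 * (1 - α ^ 2))

section
variable {α : ℝ} (hα : 2 * α ^ 2 < 1)
include hα

theorem quarter_le_one_sub : 1 / 4 ≤ 1 - α := by nlinarith [sq_nonneg (α - 3 / 4)]

theorem quarter_le_one_add : 1 / 4 ≤ 1 + α := by nlinarith [sq_nonneg (α + 3 / 4)]

theorem sqrt_pos_of_lt : 0 < √(1 - 2 * α ^ 2) := Real.sqrt_pos.mpr (by linarith)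

theorem sqrt_sq_of_lt : √(1 - 2 * α ^ 2) ^ 2 = 1 - 2 * α ^ 2 := Real.sq_sqrt (by linarith)

theorem one_sub_sq_pos : 0 < 1 - α ^ 2 := by nlinarith

theorem sqrt_one_add_div_sq :
    √(1 + (α / √(1 - 2 * α ^ 2)) ^ 2) = √(1 - α ^ 2) / √(1 - 2 * α ^ 2) := by
  have h1 : 0 < 1 - 2 * α ^ 2 := by linarith
  rw [← Real.sqrt_div (one_sub_sq_pos hα).le, div_pow, sqrt_sq_of_lt hα]
  congr 1
  rw [eq_div_iff h1.ne', add_mul, div_mul_cancel₀ _ h1.ne']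
  ring

theorem cos_omega : Real.cos (omega α) = √(1 - 2 * α ^ 2) / √(1 - α ^ 2) := by
  rw [omega, Real.cos_arctan, sqrt_one_add_div_sq hα, one_div_div]

theorem sin_omega : Real.sin (omega α) = α / √(1 - α ^ 2) := by
  rw [omega, Real.sin_arctan, sqrt_one_add_div_sq hα, div_div_div_cancel_right₀]
  exact (sqrt_pos_of_lt hα).ne'

theorem exp_omega : Complex.exp (omega α * I) = (√(1 - 2 * α ^ 2) + α * I) / √(1 - α ^ 2) := by
  rw [Complex.exp_mul_I, ← Complex.ofReal_cos, ← Complex.ofReal_sin, cos_omega hα, sin_omega hα]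
  push_cast
  ring

theorem exp_half_theta : Complex.exp ((theta α / 2 : ℝ) * I)
    = (√(1 - 2 * α ^ 2) + I) / (√2 * √(1 - α ^ 2)) := by
  have h1 := one_sub_sq_pos hα
  have hcos : Real.cos (theta α) = -α ^ 2 / (1 - α ^ 2) := by
    apply Real.cos_arccos
    · rw [le_div_iff₀ h1]; nlinarith
    · rw [div_le_iff₀ h1]; nlinarith
  have h0 : 0 ≤ theta α := Real.arccos_nonneg _
  have hpi : theta α ≤ Real.pi := Real.arccos_le_pi _
  have hc : Real.cos (theta α / 2) = √(1 - 2 * α ^ 2) / (√2 * √(1 - α ^ 2)) := by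
    rw [Real.cos_half (by linarith [Real.pi_pos]) hpi, hcos,
      ← Real.sqrt_mul zero_le_two, ← Real.sqrt_div (by linarith)]
    congr 1
    field_simp
    ring
  have hs : Real.sin (theta α / 2) = 1 / (√2 * √(1 - α ^ 2)) := by
    rw [Real.sin_half_eq_sqrt h0 (by linarith [Real.pi_pos]), hcos,
      ← Real.sqrt_mul zero_le_two, ← Real.sqrt_one, ← Real.sqrt_div zero_le_one, Real.sqrt_one]
    congr 1
    field_simp
    ring
  rw [Complex.exp_mul_I, ← Complex.ofReal_cos, ← Complex.ofReal_sin, hc, hs]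
  push_cast
  ring

theorem ofReal_sqrt_identities : (√(1 - 2 * α ^ 2) : ℂ) ^ 2 = 1 - 2 * α ^ 2 ∧
    (√(1 - α ^ 2) : ℂ) ^ 2 = 1 - α ^ 2 ∧ (√2 : ℂ) ^ 2 = 2 ∧ (1 - α : ℂ) ≠ 0 ∧ (1 + α : ℂ) ≠ 0 ∧
    (√(1 - 2 * α ^ 2) : ℂ) ≠ 0 ∧ (√(1 - α ^ 2) : ℂ) ≠ 0 ∧ (√2 : ℂ) ≠ 0 := by
  have h1 := one_sub_sq_pos hα
  have h2 := quarter_le_one_sub hα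
  have h3 := quarter_le_one_add hα
  have h4 := sqrt_pos_of_lt hα
  have h5 := Real.sqrt_pos.mpr h1
  refine ⟨by exact_mod_cast sqrt_sq_of_lt hα, by exact_mod_cast Real.sq_sqrt h1.le,
    by exact_mod_cast Real.sq_sqrt zero_le_two, ?_, ?_, by exact_mod_cast h4.ne',
    by exact_mod_cast h5.ne', by exact_mod_cast (by positivity : √2 ≠ 0)⟩
  · have : 1 - α ≠ 0 := by linarith
    exact_mod_cast this
  · have : 1 + α ≠ 0 := by linarith
    exact_mod_cast this

theorem saddleRadius_eq : saddleRadius α = √(1 - α ^ 2) / (1 - α) := by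
  have h2 := quarter_le_one_sub hα
  have h1 := one_sub_sq_pos hα
  rw [saddleRadius, Real.sqrt_eq_iff_mul_self_eq_of_pos
    (by positivity [show 0 < 1 - α by linarith])]
  rw [← pow_two, div_pow, Real.sq_sqrt h1.le]
  have : 1 - α ≠ 0 := by linarith
  field_simp
  ring

theorem saddle_eq : saddle α = saddleRadius α * Complex.exp ((Real.pi / 2 - omega α : ℝ) * I) := by
  obtain ⟨hg, hb, -, hm, -, -, hb0, -⟩ := ofReal_sqrt_identities hα
  have h : saddle α * Complex.exp (omega α * I) = saddleRadius α * I := by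
    rw [saddle, exp_omega hα, saddleRadius_eq hα]
    push_cast
    field_simp
    linear_combination α * √(1 - 2 * α ^ 2) * Complex.I_sq + I * hg - I * hb
  rw [show ((Real.pi / 2 - omega α : ℝ) : ℂ) * I = Real.pi / 2 * I - omega α * I by push_cast; ring,
    Complex.exp_sub, Complex.exp_pi_div_two_mul_I, mul_div_assoc', ← h,
    mul_div_cancel_right₀ _ (Complex.exp_ne_zero _)]

theorem saddle_sub_one : saddle α - 1
    = -√2 * Complex.exp ((-(theta α / 2 + omega α) : ℝ) * I) := by
  obtain ⟨hg, hb, h2, hm, -, -, hb0, h20⟩ := ofReal_sqrt_identities hα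
  have h : (saddle α - 1) * (Complex.exp ((theta α / 2 : ℝ) * I) * Complex.exp (omega α * I))
      = -√2 := by
    rw [saddle, exp_omega hα, exp_half_theta hα]
    field_simp
    rw [h2, hb]
    have hI := Complex.I_sq
    clear hb h2 hb0 h20
    generalize (√(1 - 2 * α ^ 2) : ℂ) = g at *
    grind
  rw [show ((-(theta α / 2 + omega α) : ℝ) : ℂ) * I
    = -((theta α / 2 : ℝ) * I + omega α * I) by push_cast; ring, Complex.exp_neg, ← h,
    Complex.exp_add, mul_inv_cancel_right₀]
  exact mul_ne_zero (Complex.exp_ne_zero _) (Complex.exp_ne_zero _)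

theorem saddle_add_one : saddle α + 1
    = √2 * Complex.exp ((-(theta α / 2 - omega α) : ℝ) * I) * saddle α := by
  obtain ⟨hg, hb, h2, hm, -, -, hb0, h20⟩ := ofReal_sqrt_identities hα
  have h : (saddle α + 1) * Complex.exp ((theta α / 2 : ℝ) * I)
      = √2 * Complex.exp (omega α * I) * saddle α := by
    rw [saddle, exp_omega hα, exp_half_theta hα]
    field_simp
    rw [h2]
    have hI := Complex.I_sq
    clear hb h2 hb0 h20
    generalize (√(1 - 2 * α ^ 2) : ℂ) = g at *
    grind
  rw [show ((-(theta α / 2 - omega α) : ℝ) : ℂ) * I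
    = omega α * I - (theta α / 2 : ℝ) * I by push_cast; ring, Complex.exp_sub]
  have := Complex.exp_ne_zero ((theta α / 2 : ℝ) * I)
  rw [mul_div_assoc', div_mul_eq_mul_div, eq_div_iff this, h]

theorem saddle_sub_one_mul_ratioP : (saddle α - 1) * ratioP α = saddle α := by
  obtain ⟨hg, hb, h2, hm, -, -, hb0, h20⟩ := ofReal_sqrt_identities hα
  rw [saddle, ratioP]
  field_simp
  have hI := Complex.I_sq
  clear hb h2 hb0 h20
  generalize (√(1 - 2 * α ^ 2) : ℂ) = g at *
  grind

theorem saddle_add_one_mul_ratioQ : (saddle α + 1) * ratioQ α = 1 := by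
  obtain ⟨hg, hb, h2, hm, hp, -, hb0, h20⟩ := ofReal_sqrt_identities hα
  rw [saddle, ratioQ]
  field_simp
  have hI := Complex.I_sq
  clear hb h2 hb0 h20
  generalize (√(1 - 2 * α ^ 2) : ℂ) = g at *
  grind

/-- The saddle point equation: the terms of the exponent that are linear in `s` cancel. -/
theorem half_mul_ratioP : (1 - α) / 2 * ratioP α = (1 + α) / 2 * ratioQ α := by
  obtain ⟨hg, hb, h2, hm, hp, -, hb0, h20⟩ := ofReal_sqrt_identities hα
  rw [ratioP, ratioQ]
  field_simp

/-- The quadratic coefficient of `a log (1 + P (e^{is} - 1)) + b log (1 + Q (e^{-is} - 1))` in `s`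
is `-curvature α`. -/
theorem curvature_eq : (1 - α) / 2 * ((ratioP α - ratioP α ^ 2) / 2)
      + (1 + α) / 2 * ((ratioQ α - ratioQ α ^ 2) / 2)
    = curvature α := by
  obtain ⟨hg, hb, h2, hm, hp, -, hb0, h20⟩ := ofReal_sqrt_identities hα
  rw [ratioP, ratioQ, curvature, show (1 - α ^ 2 : ℂ) = (1 - α) * (1 + α) by ring]
  field_simp
  have hI := Complex.I_sq
  clear hb h2 hb0 h20
  generalize (√(1 - 2 * α ^ 2) : ℂ) = g at *
  grind

theorem norm_ratioP_le : ‖ratioP α‖ ≤ 4 := by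
  have h2 := quarter_le_one_sub hα
  have h1 : √(1 - 2 * α ^ 2) ≤ 1 := Real.sqrt_le_one.mpr (by nlinarith)
  have h3 : ‖(1 : ℂ) - √(1 - 2 * α ^ 2) * I‖ ≤ 2 := by
    refine (norm_sub_le _ _).trans ?_
    simp [abs_of_nonneg]
    linarith
  rw [ratioP, norm_div, show (2 * (1 - α) : ℂ) = ((2 * (1 - α) : ℝ) : ℂ) by push_cast; ring,
    Complex.norm_real, Real.norm_of_nonneg (by linarith), div_le_iff₀ (by linarith)]
  linarith

theorem norm_ratioQ_le : ‖ratioQ α‖ ≤ 4 := by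
  have h : ratioQ α = ratioP (-α) := by simp [ratioQ, ratioP]
  rw [h]
  exact norm_ratioP_le (by simpa using hα)

end

/-! ### The integrand on the circle through the saddle points -/

/-- The integrand `w^σ (w - 1)^k ((w + 1) / w)^B` at the point `w = w₀ e^{is}` of the circle through
the saddle point `w₀`, divided by its value at `w₀`. -/
noncomputable def saddleQuotient (α : ℝ) (σ k B : ℕ) (s : ℝ) : ℂ :=
  Complex.exp (s * I) ^ σ * (1 + ratioP α * (Complex.exp (s * I) - 1)) ^ k *
    (1 + ratioQ α * (Complex.exp (-(s * I)) - 1)) ^ B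

theorem continuous_saddleQuotient (α : ℝ) (σ k B : ℕ) : Continuous (saddleQuotient α σ k B) := by
  unfold saddleQuotient
  fun_prop

theorem abs_omega_lt (α : ℝ) : |omega α| < Real.pi / 2 :=
  abs_lt.mpr ⟨Real.neg_pi_div_two_lt_arctan _, Real.arctan_lt_pi_div_two _⟩

section
variable {α : ℝ} (hα : 2 * α ^ 2 < 1)
include hα

theorem saddleRadius_pos : 0 < saddleRadius α := by
  have h1 := quarter_le_one_sub hα
  have h2 := quarter_le_one_add hα
  exact Real.sqrt_pos.mpr (div_pos (by linarith) (by linarith))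

theorem saddle_ne_zero : saddle α ≠ 0 := by
  rw [saddle_eq hα]
  exact mul_ne_zero (by exact_mod_cast (saddleRadius_pos hα).ne') (Complex.exp_ne_zero _)

theorem saddle_mul_exp (s : ℝ) : saddle α * Complex.exp (s * I)
    = saddleRadius α * Complex.exp ((Real.pi / 2 - omega α + s : ℝ) * I) := by
  rw [saddle_eq hα, mul_assoc, ← Complex.exp_add]
  congr 2
  push_cast
  ring

theorem saddle_mul_exp_sub_one (s : ℝ) : saddle α * Complex.exp (s * I) - 1
    = (saddle α - 1) * (1 + ratioP α * (Complex.exp (s * I) - 1)) := by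
  linear_combination -(Complex.exp (s * I) - 1) * saddle_sub_one_mul_ratioP hα

theorem saddle_mul_exp_add_one (s : ℝ) : saddle α * Complex.exp (s * I) + 1
    = (saddle α + 1) * (Complex.exp (s * I) * (1 + ratioQ α * (Complex.exp (-(s * I)) - 1))) := by
  have h : Complex.exp (s * I) * Complex.exp (-(s * I)) = 1 := by
    rw [← Complex.exp_add, add_neg_cancel, Complex.exp_zero]
  linear_combination (-(saddle α + 1) * ratioQ α) * h
    + (Complex.exp (s * I) - 1) * saddle_add_one_mul_ratioQ hα

theorem integrand_eq_mul_saddleQuotient (σ k B : ℕ) (s : ℝ) :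
    (saddle α * Complex.exp (s * I)) ^ σ * ((saddle α * Complex.exp (s * I) - 1) ^ k *
        (saddle α * Complex.exp (s * I) + 1) ^ B) * (saddle α * Complex.exp (s * I)) ^ (-(B : ℤ))
      = (saddle α ^ σ * (saddle α - 1) ^ k * ((saddle α + 1) / saddle α) ^ B)
        * saddleQuotient α σ k B s := by
  have h0 := saddle_ne_zero hα
  have h1 := Complex.exp_ne_zero (s * I)
  rw [saddle_mul_exp_sub_one hα, saddle_mul_exp_add_one hα, saddleQuotient, zpow_neg, zpow_natCast]
  simp only [mul_pow, div_pow]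
  field_simp

theorem norm_sq_circle_sub (τ : ℝ) (x : ℝ) :
    ‖(saddleRadius α : ℂ) * Complex.exp (τ * I) + x‖ ^ 2
      = (1 + α) / (1 - α) + 2 * x * (√(1 - α ^ 2) * Real.cos τ) / (1 - α) + x ^ 2 := by
  have h1 := quarter_le_one_sub hα
  have h2 := quarter_le_one_add hα
  have hr : saddleRadius α ^ 2 = (1 + α) / (1 - α) :=
    Real.sq_sqrt (div_nonneg (by linarith) (by linarith))
  rw [← Complex.normSq_eq_norm_sq, Complex.exp_mul_I, ← Complex.ofReal_cos, ← Complex.ofReal_sin,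
    Complex.normSq_apply]
  simp only [Complex.add_re, Complex.add_im, Complex.ofReal_re, Complex.ofReal_im, Complex.mul_re,
    Complex.mul_im, Complex.I_re, Complex.I_im]
  have e : 2 * x * (√(1 - α ^ 2) * Real.cos τ) / (1 - α) = 2 * x * saddleRadius α * Real.cos τ := by
    rw [saddleRadius_eq hα]; ring
  rw [e, ← hr]
  linear_combination saddleRadius α ^ 2 * Real.sin_sq_add_cos_sq τ

theorem norm_sq_factorP (s : ℝ) : ‖1 + ratioP α * (Complex.exp (s * I) - 1)‖ ^ 2
    = 1 - (√(1 - α ^ 2) * Real.cos (Real.pi / 2 - omega α + s) - α) / (1 - α) := by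
  have h1 := quarter_le_one_sub hα
  have h := norm_sq_circle_sub hα (Real.pi / 2 - omega α + s) (-1)
  rw [← saddle_mul_exp hα, Complex.ofReal_neg, Complex.ofReal_one, ← sub_eq_add_neg,
    saddle_mul_exp_sub_one hα, norm_mul, mul_pow, saddle_sub_one hα, norm_mul,
    Complex.norm_exp_ofReal_mul_I, norm_neg, Complex.norm_real,
    Real.norm_of_nonneg (Real.sqrt_nonneg _), mul_one, Real.sq_sqrt zero_le_two] at h
  have : 1 - α ≠ 0 := by linarith
  field_simp at h ⊢
  linarith

theorem norm_sq_factorQ (s : ℝ) : ‖1 + ratioQ α * (Complex.exp (-(s * I)) - 1)‖ ^ 2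
    = 1 + (√(1 - α ^ 2) * Real.cos (Real.pi / 2 - omega α + s) - α) / (1 + α) := by
  have h1 := quarter_le_one_sub hα
  have h2 := quarter_le_one_add hα
  have hr : ‖saddle α‖ ^ 2 = (1 + α) / (1 - α) := by
    rw [saddle_eq hα, norm_mul, Complex.norm_exp_ofReal_mul_I, mul_one, Complex.norm_real,
      Real.norm_of_nonneg (saddleRadius_pos hα).le]
    exact Real.sq_sqrt (div_nonneg (by linarith) (by linarith))
  have h := norm_sq_circle_sub hα (Real.pi / 2 - omega α + s) 1
  rw [← saddle_mul_exp hα, Complex.ofReal_one, saddle_mul_exp_add_one hα, norm_mul, norm_mul,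
    Complex.norm_exp_ofReal_mul_I, one_mul, mul_pow, saddle_add_one hα, norm_mul, norm_mul,
    Complex.norm_exp_ofReal_mul_I, Complex.norm_real,
    Real.norm_of_nonneg (Real.sqrt_nonneg _), mul_one, mul_pow, Real.sq_sqrt zero_le_two, hr] at h
  have : 1 - α ≠ 0 := by linarith
  have : 1 + α ≠ 0 := by linarith
  field_simp at h ⊢
  linarith

/-- The Gaussian bound on the whole upper half circle. -/
theorem norm_saddleQuotient_le {t s : ℝ} {σ k B : ℕ} (hA : (k : ℝ) + 1 = t * (1 - α) / 2)
    (hB : (B : ℝ) = t * (1 + α) / 2)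
    (hs : s ∈ Set.Icc (-(Real.pi / 2 - omega α)) (Real.pi / 2 + omega α)) :
    ‖saddleQuotient α σ k B s‖ ≤ 3 * Real.exp (-((1 - 2 * α ^ 2) / 160 * (t * s ^ 2))) := by
  have h1 := quarter_le_one_sub hα
  have h2 := quarter_le_one_add hα
  have hb := Real.sqrt_pos.mpr (one_sub_sq_pos hα)
  have hω := abs_lt.mp (abs_omega_lt α)
  have ht : 0 ≤ t := by
    by_contra! h
    have : t * (1 - α) ≤ 0 := mul_nonpos_of_nonpos_of_nonneg h.le (by linarith)
    have : (0 : ℝ) ≤ k := Nat.cast_nonneg k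
    linarith
  set y := √(1 - α ^ 2) * Real.cos (Real.pi / 2 - omega α + s) - α with hy
  have hP := norm_sq_factorP hα s
  have hQ := norm_sq_factorQ hα s
  rw [← hy] at hP hQ
  have hsq : ‖saddleQuotient α σ k B s‖ ^ 2 ≤ Real.exp 2 * Real.exp (-(t * y ^ 2 / 8)) := by
    rw [saddleQuotient, norm_mul, norm_mul, norm_pow, Complex.norm_exp_ofReal_mul_I, one_pow,
      one_mul, norm_pow, norm_pow, mul_pow, ← pow_mul, ← pow_mul, mul_comm k, mul_comm B, pow_mul,
      pow_mul, hP, hQ]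
    exact pow_mul_pow_le_exp (by linarith) (by linarith) hA hB (hP ▸ sq_nonneg _)
      (hQ ▸ sq_nonneg _)
  have hylow : (1 - 2 * α ^ 2) * s ^ 2 / 10 ≤ y ^ 2 := by
    have h := sin_mul_abs_sub_div_pi_le (x := Real.pi / 2 - omega α + s)
      (y := Real.pi / 2 - omega α) ⟨by linarith [hs.1], by linarith [hs.2]⟩
      ⟨by linarith, by linarith⟩
    rw [Real.sin_pi_div_two_sub, cos_omega hα, add_sub_cancel_left, Real.cos_pi_div_two_sub,
      sin_omega hα] at h
    have h' := mul_le_mul_of_nonneg_left h hb.le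
    rw [← abs_of_pos hb, ← abs_mul, abs_of_pos hb, mul_sub, mul_div_cancel₀ _ hb.ne', ← hy,
      ← mul_assoc, mul_div_cancel₀ _ hb.ne'] at h'
    have h3 := pow_le_pow_left₀ (by positivity) h' 2
    rw [sq_abs, mul_pow, div_pow, sq_abs, sqrt_sq_of_lt hα] at h3
    refine le_trans ?_ h3
    have hpi : Real.pi ^ 2 ≤ 10 := by nlinarith [Real.pi_lt_d2, Real.pi_pos]
    rw [mul_div_assoc]
    have : 0 ≤ 1 - 2 * α ^ 2 := by linarith
    have := Real.pi_pos
    gcongr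
  have hfin : Real.exp 2 * Real.exp (-(t * y ^ 2 / 8))
      ≤ (3 * Real.exp (-((1 - 2 * α ^ 2) / 160 * (t * s ^ 2)))) ^ 2 := by
    rw [mul_pow, ← Real.exp_nat_mul]
    have e2 : Real.exp 2 ≤ 3 ^ 2 := by
      rw [show (2 : ℝ) = ((2 : ℕ) : ℝ) * 1 by norm_num, Real.exp_nat_mul]
      gcongr
      linarith [Real.exp_one_lt_d9]
    gcongr
    push_cast
    nlinarith
  exact le_of_sq_le_sq (hsq.trans hfin) (by positivity)

end

/-! ### Expansion at the saddle point -/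

open MeasureTheory

/-- The cubic Taylor coefficient of `log (1 + P (e^z - 1))` at `z = 0`. -/
noncomputable def cubicCoeff (P : ℂ) : ℂ := P / 6 - P ^ 2 / 2 + P ^ 3 / 3

theorem norm_cubicCoeff_le {P : ℂ} (hP : ‖P‖ ≤ 4) : ‖cubicCoeff P‖ ≤ 31 := by
  calc ‖cubicCoeff P‖ ≤ 4 / 6 + 4 ^ 2 / 2 + 4 ^ 3 / 3 := by
        refine (norm_add_le _ _).trans (add_le_add ((norm_sub_le _ _).trans ?_) ?_)
        · simp only [norm_div, norm_pow, Complex.norm_ofNat]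
          gcongr
        · simp only [norm_div, norm_pow, Complex.norm_ofNat]
          gcongr
    _ ≤ 31 := by norm_num

theorem norm_mul_I (s : ℝ) : ‖(s * I : ℂ)‖ = |s| := by simp

theorem norm_exp_mul_I_sub_one_le (s : ℝ) : ‖Complex.exp (s * I) - 1‖ ≤ |s| := by
  have h := Real.norm_exp_I_mul_ofReal_sub_one_le (x := s)
  rwa [mul_comm, Real.norm_eq_abs] at h

theorem one_add_mul_exp_sub_one_ne_zero {P : ℂ} {s : ℝ} (hP : ‖P‖ ≤ 4) (hs : |s| ≤ 1 / 8) :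
    1 + P * (Complex.exp (s * I) - 1) ≠ 0 := by
  intro h
  have h1 : ‖P * (Complex.exp (s * I) - 1)‖ ≤ 4 * (1 / 8) := by
    rw [norm_mul]
    gcongr
    exact (norm_exp_mul_I_sub_one_le s).trans hs
  rw [show P * (Complex.exp (s * I) - 1) = -1 by linear_combination h, norm_neg, norm_one] at h1
  norm_num at h1

theorem norm_log_sub_taylor_le {P : ℂ} {s : ℝ} (hP : ‖P‖ ≤ 4) (hs : |s| ≤ 1 / 8) :
    ‖Complex.log (1 + P * (Complex.exp (s * I) - 1)) -
      (P * I * s - (P - P ^ 2) / 2 * s ^ 2 - cubicCoeff P * I * s ^ 3)‖ ≤ 228 * s ^ 4 := by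
  have h := norm_log_one_add_mul_exp_sub_one_sub_le (P := P) (z := s * I) hP
    (by rwa [norm_mul_I]) (by rw [norm_mul_I]; exact norm_exp_mul_I_sub_one_le s)
  rw [norm_mul_I, Even.pow_abs (by decide)] at h
  refine le_trans (le_of_eq ?_) h
  congr 2
  rw [cubicCoeff]
  linear_combination (-(P - P ^ 2) / 2 * s ^ 2
    - (P / 6 - P ^ 2 / 2 + P ^ 3 / 3) * s ^ 3 * I) * Complex.I_sq

section
variable {α : ℝ} (hα : 2 * α ^ 2 < 1)
include hα

theorem le_re_curvature : (1 - 2 * α ^ 2) / 4 ≤ (curvature α).re := by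
  have h1 := one_sub_sq_pos hα
  have h : (curvature α).re = (1 - 2 * α ^ 2) / (4 * (1 - α ^ 2)) := by
    have e : curvature α = (((1 - 2 * α ^ 2) / (4 * (1 - α ^ 2)) : ℝ) : ℂ)
        + ((√(1 - 2 * α ^ 2) * α ^ 2 / (4 * (1 - α ^ 2)) : ℝ) : ℂ) * I := by
      rw [curvature]
      push_cast
      rw [← (ofReal_sqrt_identities hα).1]
      ring
    rw [e, Complex.add_re, Complex.ofReal_re, Complex.re_ofReal_mul, Complex.I_re, mul_zero,
      add_zero]
  rw [h]
  have : 0 ≤ 1 - 2 * α ^ 2 := by linarith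
  gcongr
  nlinarith [sq_nonneg α]

/-- The exponent of the integrand near the saddle point. The exponent of `w - 1` is
`t (1 - α) / 2 - 1`, whence the summand `-P i s`, which does not grow with `t`. -/
theorem saddleQuotient_eq_exp {t s : ℝ} {σ k B : ℕ}
    (hA : (k : ℝ) + 1 = t * (1 - α) / 2) (hB : (B : ℝ) = t * (1 + α) / 2) (ht : 0 ≤ t)
    (hs : |s| ≤ 1 / 8) :
    ∃ u : ℂ, saddleQuotient α σ k B s = Complex.exp u ∧
      ‖u - (-(t * curvature α) * s ^ 2 + ((σ - ratioP α) * I * s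
        + t * (((1 + α) / 2 * cubicCoeff (ratioQ α) - (1 - α) / 2 * cubicCoeff (ratioP α)) * I)
          * s ^ 3))‖ ≤ 300 * (s ^ 2 + t * s ^ 4) := by
  have h1 := quarter_le_one_sub hα
  have h2 := quarter_le_one_add hα
  have hP := norm_ratioP_le hα
  have hQ := norm_ratioQ_le hα
  have hs' : |-s| ≤ 1 / 8 := by rwa [abs_neg]
  have hp0 := one_add_mul_exp_sub_one_ne_zero hP hs
  have hq0 := one_add_mul_exp_sub_one_ne_zero hQ hs'
  have hp := norm_log_sub_taylor_le hP hs
  have hq := norm_log_sub_taylor_le hQ hs'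
  rw [Complex.ofReal_neg, neg_mul] at hq0
  rw [Complex.ofReal_neg, neg_mul, Even.neg_pow (by decide : Even 4), neg_sq,
    Odd.neg_pow (by decide : Odd 3)] at hq
  set P := ratioP α with hPdef
  set Q := ratioQ α with hQdef
  set lp := Complex.log (1 + P * (Complex.exp (s * I) - 1)) with hlp
  set lq := Complex.log (1 + Q * (Complex.exp (-(s * I)) - 1)) with hlq
  set ep := lp - (P * I * s - (P - P ^ 2) / 2 * s ^ 2 - cubicCoeff P * I * s ^ 3) with hep
  set eq := lq - (Q * I * -s - (Q - Q ^ 2) / 2 * s ^ 2 - cubicCoeff Q * I * -s ^ 3) with heq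
  refine ⟨σ * (s * I) + k * lp + B * lq, ?_, ?_⟩
  · rw [Complex.exp_add, Complex.exp_add, Complex.exp_nat_mul, Complex.exp_nat_mul,
      Complex.exp_nat_mul, hlp, hlq, Complex.exp_log hp0, Complex.exp_log hq0, saddleQuotient]
  have hA' : (k : ℂ) = t * ((1 - α) / 2) - 1 := by
    have : (k : ℝ) = t * ((1 - α) / 2) - 1 := by linarith
    exact_mod_cast this
  have hB' : (B : ℂ) = t * ((1 + α) / 2) := by
    have : (B : ℝ) = t * ((1 + α) / 2) := by linarith
    exact_mod_cast this
  have hPQ := half_mul_ratioP hα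
  rw [← hPdef, ← hQdef] at hPQ
  have e : σ * (s * I) + k * lp + B * lq - (-(t * curvature α) * s ^ 2 + ((σ - P) * I * s
        + t * (((1 + α) / 2 * cubicCoeff Q - (1 - α) / 2 * cubicCoeff P) * I) * s ^ 3))
      = (k * ep + B * eq) + ((P - P ^ 2) / 2 * s ^ 2 + cubicCoeff P * I * s ^ 3) := by
    rw [hep, heq, ← curvature_eq hα, ← hPdef, ← hQdef, hA', hB']
    linear_combination (t * I * s) * hPQ
  rw [e]
  have b1 : ‖(k * ep + B * eq : ℂ)‖ ≤ k * (228 * s ^ 4) + B * (228 * s ^ 4) := by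
    refine (norm_add_le _ _).trans ?_
    rw [norm_mul, norm_mul, Complex.norm_natCast, Complex.norm_natCast]
    gcongr
  have b2 : ‖(P - P ^ 2) / 2 * (s : ℂ) ^ 2 + cubicCoeff P * I * s ^ 3‖ ≤ 14 * s ^ 2 := by
    have hns : ‖(s : ℂ)‖ = |s| := by rw [Complex.norm_real, Real.norm_eq_abs]
    have a1 : ‖P - P ^ 2‖ ≤ 4 + 4 ^ 2 := by
      refine (norm_sub_le _ _).trans ?_
      rw [norm_pow]
      gcongr
    have a2 := norm_cubicCoeff_le hP
    calc _ ≤ (4 + 4 ^ 2) / 2 * |s| ^ 2 + 31 * |s| ^ 3 := by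
          refine (norm_add_le _ _).trans (add_le_add ?_ ?_)
          · rw [norm_mul, norm_div, norm_pow, hns, Complex.norm_ofNat]
            gcongr
          · rw [norm_mul, norm_mul, norm_pow, hns, Complex.norm_I, mul_one]
            gcongr
      _ ≤ (4 + 4 ^ 2) / 2 * |s| ^ 2 + 31 * (|s| ^ 2 * (1 / 8)) := by
          rw [pow_succ |s| 2]
          gcongr
      _ ≤ _ := by rw [sq_abs]; nlinarith [sq_nonneg s]
  have hkB : (k : ℝ) + B ≤ t := by linarith
  have b3 : ((k : ℝ) + B) * (228 * s ^ 4) ≤ t * (228 * s ^ 4) := by gcongr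
  have b4 : 0 ≤ t * s ^ 4 := by positivity
  have := (norm_add_le _ _).trans (add_le_add b1 b2)
  nlinarith [sq_nonneg s]

/-- The principal square root in the complex Gaussian integral, in terms of `θ`. -/
theorem gaussian_factor_eq {t : ℝ} (ht : 0 < t) :
    (Real.pi / (t * curvature α)) ^ (1 / 2 : ℂ)
      = ((2 * √(Real.pi / (t * √(1 - 2 * α ^ 2))) : ℝ) : ℂ) *
        Complex.exp ((-(theta α / 2 - Real.pi / 4) : ℝ) * I) := by
  obtain ⟨hg, hb, h2, hm, hp, hg0, hb0, h20⟩ := ofReal_sqrt_identities hα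
  have hγ := sqrt_pos_of_lt hα
  have hpi := Real.pi_pos
  have h0 : 0 ≤ theta α := Real.arccos_nonneg _
  have h1 : theta α ≤ Real.pi := Real.arccos_le_pi _
  set v : ℂ := ((2 * √(Real.pi / (t * √(1 - 2 * α ^ 2))) : ℝ) : ℂ) *
    Complex.exp ((-(theta α / 2 - Real.pi / 4) : ℝ) * I) with hv
  have hre : 0 < v.re := by
    rw [hv, Complex.re_ofReal_mul, Complex.exp_ofReal_mul_I_re, Real.cos_neg]
    have : 0 < Real.cos (theta α / 2 - Real.pi / 4) :=
      Real.cos_pos_of_mem_Ioo ⟨by linarith, by linarith⟩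
    positivity
  have hsq : v ^ 2 = Real.pi / (t * curvature α) := by
    have e1 : Complex.exp ((-(theta α / 2 - Real.pi / 4) : ℝ) * I) ^ 2
        = I / (Complex.exp ((theta α / 2 : ℝ) * I)) ^ 2 := by
      rw [← Complex.exp_nat_mul, ← Complex.exp_nat_mul, eq_div_iff (Complex.exp_ne_zero _),
        ← Complex.exp_add]
      convert Complex.exp_pi_div_two_mul_I using 2
      push_cast
      ring
    have e2 : (((2 * √(Real.pi / (t * √(1 - 2 * α ^ 2))) : ℝ) : ℂ)) ^ 2
        = 4 * (Real.pi / (t * √(1 - 2 * α ^ 2))) := by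
      rw [← Complex.ofReal_pow, mul_pow, Real.sq_sqrt (by positivity)]
      push_cast
      ring
    have ht' : (t : ℂ) ≠ 0 := by exact_mod_cast ht.ne'
    have hβ : (1 - α ^ 2 : ℂ) ≠ 0 := by rw [← hb]; exact pow_ne_zero 2 hb0
    have hc1 : (√(1 - 2 * α ^ 2) + α ^ 2 * I : ℂ) ≠ 0 := by
      intro h
      have := congrArg Complex.re h
      rw [show (α : ℂ) ^ 2 = ((α ^ 2 : ℝ) : ℂ) by push_cast; ring] at this
      simp only [Complex.add_re, Complex.ofReal_re, Complex.re_ofReal_mul, Complex.I_re, mul_zero,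
        add_zero, Complex.zero_re] at this
      linarith
    have hc2 : (√(1 - 2 * α ^ 2) + I : ℂ) ≠ 0 := by
      intro h
      have := congrArg Complex.im h
      simp at this
    rw [hv, mul_pow, e1, e2, exp_half_theta hα, curvature, div_pow, mul_pow, h2, hb]
    have hI := Complex.I_sq
    rw [mul_comm ((α : ℂ) ^ 2) I] at hc1 ⊢
    field_simp
    clear hb h2 hb0 h20 e1 e2 hre hv
    generalize (√(1 - 2 * α ^ 2) : ℂ) = g at *
    grind
  rw [← hsq, one_div]
  exact Complex.sq_cpow_two_inv hre

end

theorem integral_saddleQuotient_asymptotics {g₀ : ℝ} (hg₀ : 0 < g₀) :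
    ∃ C : ℝ, 0 ≤ C ∧ ∀ (α t : ℝ) (σ k B : ℕ), g₀ ≤ 1 - 2 * α ^ 2 → σ ≤ 1 →
      (k : ℝ) + 1 = t * (1 - α) / 2 → (B : ℝ) = t * (1 + α) / 2 →
      ‖(∫ s in Set.Ioc (-(Real.pi / 2 - omega α)) (Real.pi / 2 + omega α),
          saddleQuotient α σ k B s) -
        ((2 * √(Real.pi / (t * √(1 - 2 * α ^ 2))) : ℝ) : ℂ) *
          Complex.exp ((-(theta α / 2 - Real.pi / 4) : ℝ) * I)‖ ≤ C / (t * √t) := by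
  obtain ⟨C, hC0, hC⟩ := laplace_integral (c := g₀ / 160) (η := g₀ / 8) (K := 300)
    (by positivity) (by positivity) (by norm_num)
  refine ⟨C, hC0, fun α t σ k B hg hσ hA hB => ?_⟩
  have hα : 2 * α ^ 2 < 1 := by linarith
  have h1 := quarter_le_one_sub hα
  have h2 := quarter_le_one_add hα
  have ht : 1 ≤ t := by
    have := Nat.cast_nonneg (α := ℝ) k
    have := Nat.cast_nonneg (α := ℝ) B
    linarith
  have hg1 : g₀ ≤ 1 := by nlinarith [sq_nonneg α]
  have hγ : g₀ ≤ Real.cos (omega α) := by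
    rw [cos_omega hα, le_div_iff₀ (Real.sqrt_pos.mpr (one_sub_sq_pos hα))]
    have a1 : √(1 - α ^ 2) ≤ 1 := Real.sqrt_le_one.mpr (by nlinarith [sq_nonneg α])
    have a2 : √(1 - 2 * α ^ 2) ≤ 1 := Real.sqrt_le_one.mpr (by nlinarith [sq_nonneg α])
    have a3 := sqrt_sq_of_lt hα
    have a4 := sqrt_pos_of_lt hα
    nlinarith
  have hω := abs_lt.mp (abs_omega_lt α)
  have hω1 : g₀ ≤ Real.pi / 2 - omega α := by
    rw [← Real.sin_pi_div_two_sub] at hγ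
    exact hγ.trans (Real.sin_le (by linarith))
  have hω2 : g₀ ≤ Real.pi / 2 + omega α := by
    rw [← Real.cos_neg, ← Real.sin_pi_div_two_sub, sub_neg_eq_add] at hγ
    exact hγ.trans (Real.sin_le (by linarith))
  have hl : ‖((σ - ratioP α) * I : ℂ)‖ ≤ 300 := by
    rw [norm_mul, Complex.norm_I, mul_one]
    refine (norm_sub_le _ _).trans ?_
    have : (σ : ℝ) ≤ 1 := by exact_mod_cast hσ
    rw [Complex.norm_natCast]
    linarith [norm_ratioP_le hα]
  have hh : ‖((1 + α) / 2 * cubicCoeff (ratioQ α) - (1 - α) / 2 * cubicCoeff (ratioP α)) * I‖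
      ≤ 300 := by
    rw [norm_mul, Complex.norm_I, mul_one]
    refine (norm_sub_le _ _).trans ?_
    rw [norm_mul, norm_mul, show ((1 + α) / 2 : ℂ) = (((1 + α) / 2 : ℝ) : ℂ) by push_cast; ring,
      show ((1 - α) / 2 : ℂ) = (((1 - α) / 2 : ℝ) : ℂ) by push_cast; ring, Complex.norm_real,
      Complex.norm_real, Real.norm_of_nonneg (by linarith), Real.norm_of_nonneg (by linarith)]
    have b1 := norm_cubicCoeff_le (norm_ratioP_le hα)
    have b2 := norm_cubicCoeff_le (norm_ratioQ_le hα)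
    calc _ ≤ (1 + α) / 2 * 31 + (1 - α) / 2 * 31 := by
          refine add_le_add ?_ ?_ <;> gcongr
      _ ≤ 300 := by linarith
  have := hC t ht (saddleQuotient α σ k B)
    (Set.Ioc (-(Real.pi / 2 - omega α)) (Real.pi / 2 + omega α)) (curvature α)
    ((σ - ratioP α) * I)
    (((1 + α) / 2 * cubicCoeff (ratioQ α) - (1 - α) / 2 * cubicCoeff (ratioP α)) * I)
    measurableSet_Ioc
    ((continuous_saddleQuotient α σ k B).integrableOn_Icc.mono_set Set.Ioc_subset_Icc_self)
    (fun s hs => ⟨by linarith [hs.1], by linarith [hs.2]⟩)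
    (by linarith [le_re_curvature hα]) hl hh ?_ ?_
  · rwa [gaussian_factor_eq hα (by linarith)] at this
  · intro s hs
    refine (norm_saddleQuotient_le hα hA hB ⟨hs.1.le, hs.2⟩).trans ?_
    gcongr
    norm_num
  · intro s hs
    exact saddleQuotient_eq_exp hα hA hB (by linarith) (hs.trans (by linarith))

/-! ### Asymptotics of the coefficients and of the amplitudes -/

open Polynomial

section
variable {α : ℝ} (hα : 2 * α ^ 2 < 1)
include hα

/-- The integrand at the saddle point in polar form. -/
theorem saddle_value_eq (σ k B : ℕ) :
    saddle α ^ σ * (saddle α - 1) ^ k * ((saddle α + 1) / saddle α) ^ B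
      = ((saddleRadius α ^ σ * (-1) ^ k * √2 ^ (k + B) : ℝ) : ℂ) *
        Complex.exp ((σ * (Real.pi / 2 - omega α) - k * (theta α / 2 + omega α)
          - B * (theta α / 2 - omega α) : ℝ) * I) := by
  have h : (saddle α + 1) / saddle α
      = √2 * Complex.exp ((-(theta α / 2 - omega α) : ℝ) * I) := by
    rw [saddle_add_one hα, mul_div_cancel_right₀ _ (saddle_ne_zero hα)]
  have e : Complex.exp ((σ * (Real.pi / 2 - omega α) - k * (theta α / 2 + omega α)
          - B * (theta α / 2 - omega α) : ℝ) * I)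
      = Complex.exp ((Real.pi / 2 - omega α : ℝ) * I) ^ σ *
        Complex.exp ((-(theta α / 2 + omega α) : ℝ) * I) ^ k *
        Complex.exp ((-(theta α / 2 - omega α) : ℝ) * I) ^ B := by
    rw [← Complex.exp_nat_mul, ← Complex.exp_nat_mul, ← Complex.exp_nat_mul, ← Complex.exp_add,
      ← Complex.exp_add]
    congr 1
    push_cast
    ring
  rw [h, e, saddle_sub_one hα, saddle_eq hα]
  push_cast
  rw [mul_pow, mul_pow, mul_pow, neg_pow, pow_add]
  ring

theorem coeff_eq_re_integral (σ k B : ℕ) :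
    Real.pi * (X ^ σ * ((X - 1) ^ k * (X + 1) ^ B) : ℝ[X]).coeff B
      = (saddle α ^ σ * (saddle α - 1) ^ k * ((saddle α + 1) / saddle α) ^ B *
          ∫ s in Set.Ioc (-(Real.pi / 2 - omega α)) (Real.pi / 2 + omega α),
            saddleQuotient α σ k B s).re := by
  have hω := abs_lt.mp (abs_omega_lt α)
  rw [← re_integral_polynomial_circle (saddleRadius_pos hα),
    ← intervalIntegral.integral_of_le (by linarith), ← intervalIntegral.integral_const_mul]
  congr 1
  have hshift := intervalIntegral.integral_comp_add_right
    (a := -(Real.pi / 2 - omega α)) (b := Real.pi / 2 + omega α)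
    (fun τ : ℝ => aeval ((saddleRadius α : ℂ) * Complex.exp (τ * I))
      (X ^ σ * ((X - 1) ^ k * (X + 1) ^ B) : ℝ[X]) *
        ((saddleRadius α : ℂ) * Complex.exp (τ * I)) ^ (-(B : ℤ))) (Real.pi / 2 - omega α)
  rw [neg_add_cancel, show Real.pi / 2 + omega α + (Real.pi / 2 - omega α) = Real.pi by ring]
    at hshift
  rw [← hshift]
  congr 1
  funext s
  rw [← integrand_eq_mul_saddleQuotient hα, add_comm s, ← saddle_mul_exp hα]
  simp

end

/-- The common asymptotics of both amplitudes: `σ = 0` is the left one, `σ = 1` the right one. -/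
theorem coeff_asymptotics {g₀ : ℝ} (hg₀ : 0 < g₀) :
    ∃ C : ℝ, 0 ≤ C ∧ ∀ (α : ℝ) (t σ k B : ℕ), g₀ ≤ 1 - 2 * α ^ 2 → σ ≤ 1 → k + 1 + B = t →
      (k : ℝ) + 1 = t * (1 - α) / 2 → (B : ℝ) = t * (1 + α) / 2 →
      ∃ e : ℝ, |e| ≤ C / t ∧ (X ^ σ * ((X - 1) ^ k * (X + 1) ^ B) : ℝ[X]).coeff B / √2 ^ t
        = (-1) ^ k * (saddleRadius α ^ σ * ampL α t) *
          (Real.cos (σ * (Real.pi / 2 - omega α) - k * (theta α / 2 + omega α)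
            - B * (theta α / 2 - omega α) - (theta α / 2 - Real.pi / 4)) + e) := by
  obtain ⟨C, hC0, hC⟩ := integral_saddleQuotient_asymptotics hg₀
  refine ⟨C, hC0, fun α t σ k B hg hσ hkt hA hB => ?_⟩
  have hα : 2 * α ^ 2 < 1 := by linarith
  have hpi := Real.pi_pos
  have ht : (0 : ℝ) < t := by
    have : 0 < t := by omega
    exact_mod_cast this
  have hγ := sqrt_pos_of_lt hα
  have hcoeff := coeff_eq_re_integral hα σ k B
  have hJ := hC α t σ k B hg hσ hA hB
  set J := ∫ s in Set.Ioc (-(Real.pi / 2 - omega α)) (Real.pi / 2 + omega α),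
    saddleQuotient α σ k B s
  set m := 2 * √(Real.pi / (t * √(1 - 2 * α ^ 2))) with hm
  rw [saddle_value_eq hα] at hcoeff
  set Φ := σ * (Real.pi / 2 - omega α) - k * (theta α / 2 + omega α)
          - B * (theta α / 2 - omega α) with hΦ
  set ψ := theta α / 2 - Real.pi / 4 with hψ
  set E := J - (m : ℂ) * Complex.exp ((-ψ : ℝ) * I) with hE
  set R := (Complex.exp ((Φ : ℝ) * I) * E).re with hR
  have hRle : |R| ≤ C / (t * √t) := by
    refine (Complex.abs_re_le_norm _).trans ?_
    rwa [norm_mul, Complex.norm_exp_ofReal_mul_I, one_mul]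
  have hm0 : 0 < m := by positivity
  have hre : (Complex.exp ((Φ : ℝ) * I) * J).re = m * Real.cos (Φ - ψ) + R := by
    have : Complex.exp ((Φ : ℝ) * I) * J
        = (m : ℂ) * Complex.exp ((Φ - ψ : ℝ) * I) + Complex.exp ((Φ : ℝ) * I) * E := by
      rw [show ((Φ - ψ : ℝ) : ℂ) * I = Φ * I + (-ψ : ℝ) * I by push_cast; ring, Complex.exp_add, hE]
      ring
    rw [this, Complex.add_re, Complex.re_ofReal_mul, Complex.exp_ofReal_mul_I_re]
  rw [mul_assoc, Complex.re_ofReal_mul, hre] at hcoeff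
  have hamp : ampL α t = m / (√2 * Real.pi) := by
    rw [ampL, hm, Real.sqrt_div hpi.le, mul_assoc, Real.sqrt_mul hpi.le]
    have : 0 < √(t * √(1 - 2 * α ^ 2)) := by positivity
    field_simp
    rw [Real.sq_sqrt zero_le_two, Real.sq_sqrt hpi.le, mul_comm]
  -- `m` is the Gaussian factor, so that `ampL` is `m / (√2 π)` and the relative error is `R / m`.
  refine ⟨R / m, ?_, ?_⟩
  · rw [abs_div, abs_of_pos hm0, div_le_iff₀ hm0]
    refine hRle.trans ?_
    rw [div_mul_eq_mul_div, div_le_div_iff₀ (by positivity) ht]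
    have hmt : 1 ≤ m * √t := by
      rw [hm, mul_assoc, ← Real.sqrt_mul (by positivity)]
      have : 1 ≤ √(Real.pi / (t * √(1 - 2 * α ^ 2)) * t) := by
        rw [Real.one_le_sqrt, div_mul_eq_mul_div, one_le_div (by positivity), mul_comm]
        have : √(1 - 2 * α ^ 2) ≤ 1 := Real.sqrt_le_one.mpr (by nlinarith [sq_nonneg α])
        have := Real.pi_gt_three
        gcongr
        linarith
      linarith
    calc C * t = C * t * 1 := by ring
      _ ≤ C * t * (m * √t) := by gcongr
      _ = _ := by ring
  · have hc : (X ^ σ * ((X - 1) ^ k * (X + 1) ^ B) : ℝ[X]).coeff B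
        = saddleRadius α ^ σ * (-1) ^ k * √2 ^ (k + B) * (m * Real.cos (Φ - ψ) + R) / Real.pi := by
      rw [eq_div_iff hpi.ne', ← hcoeff, mul_comm]
    rw [hc, hamp, ← hkt, show k + 1 + B = k + B + 1 by ring, pow_succ √2]
    field_simp

/-- The left phase in terms of `θ / 2 + ω`, `θ / 2 - ω`, the numbers of steps `k + 1` and `B`, and
the Gaussian phase `θ / 2 - π / 4`. -/
theorem phaseL_eq {α : ℝ} (hα : 2 * α ^ 2 < 1) {t k B : ℕ} (hA : (k : ℝ) + 1 = t * (1 - α) / 2)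
    (hB : (B : ℝ) = t * (1 + α) / 2) :
    phaseL α t = Real.pi / 2 - (-(k * (theta α / 2 + omega α)) - B * (theta α / 2 - omega α)
      - (theta α / 2 - Real.pi / 4)) := by
  have h1 := quarter_le_one_sub hα
  have : 1 - α ≠ 0 := by linarith
  rw [show (k : ℝ) = t * (1 - α) / 2 - 1 by linarith, hB, phaseL, rho, xiL, ← omega]
  field_simp
  ring

/-- Numbers `k + 1` of left steps and `B` of right steps leading to `n`; there is at least one left
step because `α < 1`. -/
theorem exists_walk_coordinates {t : ℕ} {n : ℤ} {α : ℝ} (ht : 1 ≤ t) (hpar : Even ((t : ℤ) - n))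
    (hαn : α = (n : ℝ) / t) (hα : 2 * α ^ 2 < 1) :
    ∃ k B : ℕ, k + 1 + B = t ∧ n = (B : ℤ) - (k + 1 : ℕ) ∧ (k : ℝ) + 1 = t * (1 - α) / 2 ∧
      (B : ℝ) = t * (1 + α) / 2 ∧ extSign n t = (-1) ^ k := by
  have h1 := quarter_le_one_sub hα
  have h2 := quarter_le_one_add hα
  have ht0 : (0 : ℝ) < t := by exact_mod_cast ht
  have hn : (n : ℝ) = α * t := by rw [hαn]; field_simp
  have hlt : n < t := by
    have : (n : ℝ) < t := by rw [hn]; nlinarith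
    exact_mod_cast this
  have hgt : -(t : ℤ) < n := by
    have : -(t : ℝ) < n := by rw [hn]; nlinarith
    exact_mod_cast this
  obtain ⟨a, ha⟩ := hpar
  obtain ⟨k, hk⟩ : ∃ k : ℕ, (k : ℤ) = a - 1 := ⟨(a - 1).toNat, by omega⟩
  obtain ⟨B, hB⟩ : ∃ B : ℕ, (B : ℤ) = a + n := ⟨(a + n).toNat, by omega⟩
  have haR : (t : ℝ) - n = a + a := by exact_mod_cast ha
  have hkR : (k : ℝ) = a - 1 := by exact_mod_cast hk
  have hBR : (B : ℝ) = a + n := by exact_mod_cast hB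
  refine ⟨k, B, by omega, by omega, by nlinarith, by nlinarith, ?_⟩
  rw [extSign, show ((t : ℤ) - n) / 2 + 1 = ((k + 2 : ℕ) : ℤ) by omega, zpow_natCast, pow_add]
  norm_num

theorem psi_asymptotics {ε : ℝ} (hε : 0 < ε) :
    ∃ C : ℝ, ∀ t : ℕ, 1 ≤ t → ∀ n : ℤ, Even ((t : ℤ) - n) →
      ∀ α : ℝ, α = (n : ℝ) / (t : ℝ) → |α| < 1 / √2 - ε →
        (∃ e : ℝ, |e| ≤ C / t ∧
          psiR n t = extSign n t * ampR α t * (Real.sin (phaseR α t) + e)) ∧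
        (∃ e : ℝ, |e| ≤ C / t ∧
          psiL n t = extSign n t * ampL α t * (Real.sin (phaseL α t) + e)) := by
  obtain ⟨C, -, hC⟩ := coeff_asymptotics hε
  refine ⟨C, fun t ht n hpar α hαn hαε => ?_⟩
  -- `1 - 2 α² ≥ 1 - √2 |α| > √2 ε`.
  have hg : ε ≤ 1 - 2 * α ^ 2 := by
    have h20 : 0 < √2 := by positivity
    have h21 : 1 ≤ √2 := Real.one_le_sqrt.mpr one_le_two
    have h3 : √2 * |α| < 1 - √2 * ε := by
      have := mul_lt_mul_of_pos_left hαε h20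
      rwa [mul_sub, mul_one_div_cancel h20.ne'] at this
    have h4 : 2 * α ^ 2 = (√2 * |α|) ^ 2 := by rw [mul_pow, sq_abs, Real.sq_sqrt zero_le_two]
    have h5 : 0 ≤ √2 * |α| := by positivity
    have h6 : ε ≤ √2 * ε := le_mul_of_one_le_left hε.le h21
    have h7 : (√2 * |α|) ^ 2 ≤ √2 * |α| := pow_le_of_le_one h5 (by linarith) two_ne_zero
    rw [h4]
    linarith
  have hα : 2 * α ^ 2 < 1 := by linarith
  obtain ⟨k, B, hkt, hn, hA, hB, hsign⟩ := exists_walk_coordinates ht hpar hαn hα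
  have hw := wave_eq_coeff t (k + 1) B hkt
  rw [← hn] at hw
  have hphase := phaseL_eq hα hA hB
  rw [hsign]
  constructor
  · obtain ⟨e, he, hce⟩ := hC α t 1 k B hg le_rfl hkt hA hB
    refine ⟨e, he, ?_⟩
    have hR : phaseR α t = Real.pi / 2 - ((1 : ℕ) * (Real.pi / 2 - omega α)
        - k * (theta α / 2 + omega α) - B * (theta α / 2 - omega α)
        - (theta α / 2 - Real.pi / 4)) := by
      have : phaseR α t = phaseL α t - Real.pi / 2 + omega α := by
        rw [phaseR, phaseL, xiR, omega]; ring
      rw [this, hphase]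
      push_cast
      ring
    rw [psiR, hw, hR, Real.sin_pi_div_two_sub, ampR, ← saddleRadius]
    simp only [rightCoeff, Nat.succ_ne_zero, if_false, Nat.add_sub_cancel]
    rw [pow_one, pow_one] at hce
    exact hce
  · obtain ⟨e, he, hce⟩ := hC α t 0 k B hg zero_le_one hkt hA hB
    refine ⟨e, he, ?_⟩
    rw [psiL, hw, hphase, Real.sin_pi_div_two_sub]
    simp only [leftCoeff, Nat.succ_ne_zero, if_false, Nat.add_sub_cancel]
    rw [pow_zero, pow_zero, one_mul, one_mul, Nat.cast_zero, zero_mul, zero_sub] at hce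
    exact hce

theorem exists_relative_error {x s e c t δ C : ℝ} (hδ : 0 < δ) (hs : δ ≤ |s|)
    (he : |e| ≤ C / t) (hx : x = c * (s + e)) :
    ∃ e' : ℝ, |e'| ≤ C / δ / t ∧ x = c * s * (1 + e') := by
  have hs0 : s ≠ 0 := abs_pos.mp (hδ.trans_le hs)
  refine ⟨e / s, ?_, by rw [hx]; field_simp⟩
  rw [abs_div, div_right_comm]
  exact div_le_div₀ ((abs_nonneg e).trans he) he hδ hs

end HadamardWalk

theorem theorem4 (ε : ℝ) (hε : 0 < ε) :
    (∃ C : ℝ, ∃ T : ℕ, ∀ t : ℕ, T ≤ t → ∀ n : ℤ, Even ((t : ℤ) - n) →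
      ∀ α : ℝ, α = (n : ℝ) / (t : ℝ) → |α| < 1 / √2 - ε →
        (∃ e : ℝ, |e| ≤ C / t ∧
          HadamardWalk.psiR n t = HadamardWalk.extSign n t * HadamardWalk.ampR α t *
            (Real.sin (HadamardWalk.phaseR α t) + e)) ∧
        (∃ e : ℝ, |e| ≤ C / t ∧
          HadamardWalk.psiL n t = HadamardWalk.extSign n t * HadamardWalk.ampL α t *
            (Real.sin (HadamardWalk.phaseL α t) + e))) ∧
    (∀ δ : ℝ, 0 < δ →
      ∃ C : ℝ, ∃ T : ℕ, ∀ t : ℕ, T ≤ t → ∀ n : ℤ, Even ((t : ℤ) - n) →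
        ∀ α : ℝ, α = (n : ℝ) / (t : ℝ) → |α| < 1 / √2 - ε →
          (δ ≤ |Real.sin (HadamardWalk.phaseR α t)| → ∃ e : ℝ, |e| ≤ C / t ∧
            HadamardWalk.psiR n t = HadamardWalk.extSign n t * HadamardWalk.ampR α t *
              Real.sin (HadamardWalk.phaseR α t) * (1 + e)) ∧
          (δ ≤ |Real.sin (HadamardWalk.phaseL α t)| → ∃ e : ℝ, |e| ≤ C / t ∧
            HadamardWalk.psiL n t = HadamardWalk.extSign n t * HadamardWalk.ampL α t *
              Real.sin (HadamardWalk.phaseL α t) * (1 + e))) := by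
  obtain ⟨C, hC⟩ := HadamardWalk.psi_asymptotics hε
  refine ⟨⟨C, 1, hC⟩, fun δ hδ => ⟨C / δ, 1, fun t ht n hpar α hαn hαε => ?_⟩⟩
  obtain ⟨⟨e, he, hR⟩, ⟨e', he', hL⟩⟩ := hC t ht n hpar α hαn hαε
  exact ⟨fun hs => HadamardWalk.exists_relative_error hδ hs he hR,
    fun hs => HadamardWalk.exists_relative_error hδ hs he' hL⟩
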